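/- An orientation of a finite simple graph $G$ is obtained by giving each edge of $G$ exactly one of its two directions. For an integer $k$, let $S_k(G)$ be the number of orientations of $G$ in which no copy of $K_k$ in $G$ is strongly connected, that is, in which no $k$-vertex clique of $G$ induces a strongly connected tournament. Let $S_k(n)=\max\{S_k(G): G \text{ is a graph on } n \text{ vertices}\}$, and call an $n$-vertex graph $G$ $k$-extremal if $S_k(G)=S_k(n)$. Let $T_{k-1}(n)$ be the Turán graph, i.e. the complete $(k-1)$-partite graph on $n$ vertices whose part sizes differ by at most one, and let $t_{k-1}(n)$ be its number of edges. Theorem. Let $n \ge k \ge 4$ be integers. (1) If $n=k=4$, then $S_4(4)=40$, and a graph on $4$ vertices is $4$-extremal if and only if it is isomorphic to $K_4$. (2) If $n\ge 5$ or $k\ge 5$, then $S_k(n)=2^{t_{k-1}(n)}$, and a graph on $n$ vertices is $k$-extremal if and only if it is isomorphic to $T_{k-1}(n)$. -/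

import Mathlib

/-- `D` is an orientation of the simple graph `G`: every arc of `D` joins adjacent vertices of `G`,
and every edge of `G` receives exactly one of its two directions. -/
def IsOrientation {V : Type*} (G : SimpleGraph V) (D : Digraph V) : Prop :=
  (∀ u v : V, G.Adj u v ↔ (D.Adj u v ∨ D.Adj v u)) ∧ ∀ u v : V, D.Adj u v → ¬ D.Adj v u

/-- The subdigraph of `D` induced on `s` is strongly connected: between any two vertices of `s`
there is a directed path (in both directions) all of whose vertices lie in `s`. -/
def StronglyConnectedOn {V : Type*} (D : Digraph V) (s : Finset V) : Prop :=
  ∀ u v : s, Relation.ReflTransGen (fun a b : s => D.Adj a b) u v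

/-- The orientations of `G` in which no copy of `K_k` is strongly connected. -/
def freeOrientations {V : Type*} (k : ℕ) (G : SimpleGraph V) : Set (Digraph V) :=
  {D | IsOrientation G D ∧ ∀ s : Finset V, G.IsNClique k s → ¬ StronglyConnectedOn D s}

/-- `S_k(G)`, the number of orientations of `G` in which no copy of `K_k` is strongly connected. -/
noncomputable def numFreeOrientations {V : Type*} (k : ℕ) (G : SimpleGraph V) : ℕ :=
  (freeOrientations k G).ncard

/-- `S_k(n)`, the maximum of `S_k(G)` over the (finitely many) graphs `G` on `n` labelled
vertices. -/
noncomputable def maxFreeOrientations (k n : ℕ) : ℕ :=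
  (Finset.univ : Finset (SimpleGraph (Fin n))).sup fun G => numFreeOrientations k G

/-- `G` is extremal: it attains the maximum `S_k(n)`, where `n` is its number of vertices. -/
def IsStrongExtremal {V : Type*} [Fintype V] (k : ℕ) (G : SimpleGraph V) : Prop :=
  numFreeOrientations k G = maxFreeOrientations k (Fintype.card V)

/-- `t_r(n)`, the number of edges of the Turán graph `T_r(n)`. -/
def turanEdges (n r : ℕ) : ℕ := (SimpleGraph.turanGraph n r).edgeFinset.card

/-! Write k = j + 3 and q = k - 1 = j + 2. A graph without `K_k` has 2^e(G) free orientations, so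
Turán's theorem settles that case together with equality. What remains is to show that a graph
containing `K_k` has strictly fewer than 2^t_q(n), outside the case n = k = 4
(`numFreeOrientations_lt_of_not_cliqueFree`, by strong induction on n).

Take a maximum clique W, of size m = q + e with e ≥ 1, and let r = n - m. A free orientation is
determined by its restrictions to W and to the complement and by the out-neighbourhood in W of each
outside vertex v (`numFreeOrientations_le_sum_prod`). By maximality v has at most m - 1 neighbours
in W. The key bound is that at most 2^j (e + 2) out-neighbourhoods are possible
(`card_freePatterns_le`). Take a Hamiltonian path of the neighbourhood with first vertex a. If v →
a, then v must dominate every vertex far enough along the path, since an arc back to v would close a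
cycle on at least k vertices, and a strong tournament on at least k vertices contains a strong one
on exactly k (`CutStrong.exists_subset_card_eq`). This leaves 2^j choices; if a → v, delete a and
induct.

It remains to compare exponents. The q-th power of 2^j (e + 2) is at most 2^((q-1)m), which matches
the superadditivity of t_q up to the cross term (q-1)mr/q (`pattern_pow_mul_le`). For `K_m` itself
the strict bound is `numFreeOrientations_top_lt`. The exception is `K_4` with k = 4, where 40 > 2^5.
It affects three cases: W of size 4, a complement of size 4, and n = 7, where the product bound
narrowly fails and one outside vertex is counted jointly with W. -/

/-! ### Strong connectivity through cuts. -/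

/-- Strong connectivity of the subdigraph induced on `s`, expressed through cuts: every proper
nonempty part of `s` is left by an arc inside `s`. -/
def CutStrong {V : Type*} (D : Digraph V) (s : Finset V) : Prop :=
  ∀ A : Set V, (∃ a ∈ s, a ∈ A) → (∃ b ∈ s, b ∉ A) → ∃ a ∈ s, a ∈ A ∧ ∃ b ∈ s, b ∉ A ∧ D.Adj a b

/-- Any two distinct vertices of `s` are joined by an arc of `D`. -/
def SemicompleteOn {V : Type*} (D : Digraph V) (s : Finset V) : Prop :=
  ∀ a ∈ s, ∀ b ∈ s, a ≠ b → D.Adj a b ∨ D.Adj b a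

/-- A set containing u and left by no arc contains everything reachable from u; conversely the set
of vertices reachable from u is left by no arc. -/
theorem stronglyConnectedOn_iff_cutStrong {V : Type*} {D : Digraph V} {s : Finset V} :
    StronglyConnectedOn D s ↔ CutStrong D s := by
  constructor
  · intro h A ⟨a, has, haA⟩ ⟨b, hbs, hbA⟩
    by_contra! hcon
    have : ∀ y : s, Relation.ReflTransGen (fun a b : s => D.Adj a b) ⟨a, has⟩ y → (y : V) ∈ A := by
      intro y hy
      induction hy with
      | refl => exact haA
      | @tail x z _ hxz ih =>
        by_contra hz
        exact hcon x x.2 ih z z.2 hz hxz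
    exact hbA (this ⟨b, hbs⟩ (h _ _))
  · intro h u v
    by_contra hcon
    obtain ⟨a, has, ⟨ha', ha⟩, b, hbs, hb, hab⟩ := h
      {x | ∃ hx : x ∈ s, Relation.ReflTransGen (fun a b : s => D.Adj a b) u ⟨x, hx⟩}
      ⟨u, u.2, u.2, Relation.ReflTransGen.refl⟩ ⟨v, v.2, fun ⟨_, hv⟩ => hcon hv⟩
    exact hb ⟨hbs, ha.tail (c := ⟨b, hbs⟩) hab⟩

theorem SemicompleteOn.mono {V : Type*} {D : Digraph V} {s t : Finset V} (h : SemicompleteOn D t) (hst : s ⊆ t) :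
    SemicompleteOn D s :=
  fun a ha b hb => h a (hst ha) b (hst hb)

theorem cutStrong_singleton {V : Type*} (D : Digraph V) (a : V) : CutStrong D {a} := by
  rintro A ⟨x, hx, hxA⟩ ⟨y, hy, hyA⟩
  simp only [Finset.mem_singleton] at hx hy
  subst hx hy
  exact absurd hxA hyA

/-! ### Strong subsets of prescribed size. -/

section Growth

variable {V : Type*} [DecidableEq V] {D : Digraph V}

theorem CutStrong.insert_vertex {s : Finset V} (h : CutStrong D s) {z x y : V} (hx : x ∈ s) (hy : y ∈ s)
    (hzx : D.Adj z x) (hyz : D.Adj y z) : CutStrong D (insert z s) := by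
  intro A hA hA'
  by_cases h1 : ∃ a ∈ s, a ∈ A
  · by_cases h2 : ∃ b ∈ s, b ∉ A
    · obtain ⟨a, ha, haA, b, hb, hbA, hab⟩ := h A h1 h2
      exact ⟨a, Finset.mem_insert_of_mem ha, haA, b, Finset.mem_insert_of_mem hb, hbA, hab⟩
    · push Not at h2
      obtain ⟨b, hb, hbA⟩ := hA'
      have hbz : b = z := by
        rcases Finset.mem_insert.1 hb with h | h
        · exact h
        · exact absurd (h2 b h) hbA
      subst hbz
      exact ⟨y, Finset.mem_insert_of_mem hy, h2 y hy, b, hb, hbA, hyz⟩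
  · push Not at h1
    obtain ⟨a, ha, haA⟩ := hA
    have haz : a = z := by
      rcases Finset.mem_insert.1 ha with h | h
      · exact h
      · exact absurd haA (h1 a h)
    subst haz
    exact ⟨a, ha, haA, x, Finset.mem_insert_of_mem hx, h1 x hx, hzx⟩

/-- In a strong semicomplete digraph, if each vertex outside `s` sends no arc to `s` or receives
none from `s`, then there is an arc `x → y` outside `s` with `s → x` and `y → s` completely. -/
theorem exists_detour {s t : Finset V} (ht : CutStrong D t) (hD : SemicompleteOn D t)
    (hst : s ⊆ t) (hs : s.Nonempty) (hne : s ≠ t)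
    (hout : ∀ z ∈ t, z ∉ s → (∀ x ∈ s, ¬ D.Adj z x) ∨ ∀ x ∈ s, ¬ D.Adj x z) :
    ∃ x ∈ t, ∃ y ∈ t, x ∉ s ∧ y ∉ s ∧ x ≠ y ∧ D.Adj x y ∧ (∀ c ∈ s, D.Adj c x) ∧
      ∀ c ∈ s, D.Adj y c := by
  obtain ⟨a₀, ha₀⟩ := hs
  have hto : ∀ z ∈ t, z ∉ s → (∀ x ∈ s, ¬ D.Adj z x) → ∀ x ∈ s, D.Adj x z := by
    intro z hz hzs h x hx
    rcases hD z hz x (hst hx) (fun e => hzs (e ▸ hx)) with h' | h'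
    · exact absurd h' (h x hx)
    · exact h'
  have hfrom : ∀ z ∈ t, z ∉ s → (∀ x ∈ s, ¬ D.Adj x z) → ∀ x ∈ s, D.Adj z x := by
    intro z hz hzs h x hx
    rcases hD z hz x (hst hx) (fun e => hzs (e ▸ hx)) with h' | h'
    · exact h'
    · exact absurd h' (h x hx)
  obtain ⟨w, hwt, hws⟩ : ∃ w ∈ t, w ∉ s := by
    by_contra! h
    exact hne (Finset.Subset.antisymm hst h)
  obtain ⟨a, ha, haA, b, hb, hbA, hab⟩ := ht (s : Set V) ⟨a₀, hst ha₀, ha₀⟩ ⟨w, hwt, hws⟩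
  simp only [Finset.mem_coe] at haA hbA
  have hbO : ∀ x ∈ s, ¬ D.Adj b x := by
    -- The outside vertices split into those sending no arc to `s` and those receiving none. An arc
    -- leaving `s` ends in the first class, and an arc leaving that class must end in the second.
    rcases hout b hb hbA with h | h
    · exact h
    · exact absurd hab (h a haA)
  obtain ⟨x, hx, ⟨hxs, hxO⟩, y, hy, hyA, hxy⟩ := ht {z | z ∉ s ∧ ∀ x ∈ s, ¬ D.Adj z x}
    ⟨b, hb, hbA, hbO⟩ ⟨a₀, hst ha₀, fun h => h.1 ha₀⟩
  have hys : y ∉ s := fun h => hxO y h hxy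
  have hyI : ∀ x ∈ s, ¬ D.Adj x y := by
    rcases hout y hy hys with h | h
    · exact absurd ⟨hys, h⟩ hyA
    · exact h
  refine ⟨x, hx, y, hy, hxs, hys, ?_, hxy, hto x hx hxs hxO, hfrom y hy hys hyI⟩
  rintro rfl
  exact hyA ⟨hxs, hxO⟩

/-- Each c in `s` lies on the triangle c → x → y → c, so no arc inside `s` is needed. Hence the
lemma still applies after vertices of `s` are discarded. -/
theorem cutStrong_insert_detour {s : Finset V} (hs : s.Nonempty) {x y : V} (hxy : D.Adj x y)
    (hx : ∀ c ∈ s, D.Adj c x) (hy : ∀ c ∈ s, D.Adj y c) :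
    CutStrong D (insert x (insert y s)) := by
  obtain ⟨c₀, hc₀⟩ := hs
  intro A hA hA'
  have mx : x ∈ insert x (insert y s) := by simp
  have my : y ∈ insert x (insert y s) := by simp
  have ms : ∀ c ∈ s, c ∈ insert x (insert y s) := by intro c hc; simp [hc]
  by_cases hxA : x ∈ A
  · by_cases hyA : y ∈ A
    · obtain ⟨b, hb, hbA⟩ := hA'
      simp only [Finset.mem_insert] at hb
      rcases hb with rfl | rfl | hb
      · exact absurd hxA hbA
      · exact absurd hyA hbA
      · exact ⟨y, my, hyA, b, ms b hb, hbA, hy b hb⟩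
    · exact ⟨x, mx, hxA, y, my, hyA, hxy⟩
  · by_cases h : ∃ c ∈ s, c ∈ A
    · obtain ⟨c, hc, hcA⟩ := h
      exact ⟨c, ms c hc, hcA, x, mx, hxA, hx c hc⟩
    · push Not at h
      obtain ⟨a, ha, haA⟩ := hA
      simp only [Finset.mem_insert] at ha
      rcases ha with rfl | rfl | ha
      · exact absurd haA hxA
      · exact ⟨a, my, haA, c₀, ms c₀ hc₀, h c₀ hc₀, hy c₀ hc₀⟩
      · exact absurd haA (h a ha)

/-- A strong semicomplete digraph on at least `k ≥ 3` vertices contains a strong subdigraph on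
exactly `k` vertices. -/
theorem CutStrong.exists_subset_card_eq {t : Finset V} (ht : CutStrong D t)
    (hD : SemicompleteOn D t) {k : ℕ} (hk : 3 ≤ k) (hkt : k ≤ t.card) :
    ∃ s ⊆ t, s.card = k ∧ CutStrong D s := by
  induction k, hk using Nat.le_induction with
  | base =>
    obtain ⟨a, ha⟩ : t.Nonempty := Finset.card_pos.1 (by omega)
    by_cases hout : ∀ z ∈ t, z ∉ ({a} : Finset V) →
        (∀ x ∈ ({a} : Finset V), ¬ D.Adj z x) ∨ ∀ x ∈ ({a} : Finset V), ¬ D.Adj x z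
    · obtain ⟨x, hx, y, hy, hxs, hys, hne, hxy, h1, h2⟩ := exists_detour (s := {a}) ht hD
        (by simpa using ha) (by simp) (by rintro rfl; simp at hkt) hout
      refine ⟨insert x (insert y {a}), ?_, ?_, cutStrong_insert_detour (by simp) hxy h1 h2⟩
      · intro z hz
        simp only [Finset.mem_insert, Finset.mem_singleton] at hz
        rcases hz with rfl | rfl | rfl <;> assumption
      · simp only [Finset.mem_singleton] at hxs hys
        exact Finset.card_eq_three.2 ⟨x, y, a, hne, hxs, hys, rfl⟩
    · push Not at hout
      obtain ⟨z, hz, hza, ⟨x, hx, hzx⟩, ⟨y, hy, hyz⟩⟩ := hout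
      -- A semicomplete digraph may contain 2-cycles, so z and a can form a strong pair, which then
      -- has to grow to size three.
      have hs : CutStrong D (insert z {a}) := (cutStrong_singleton D a).insert_vertex hx hy hzx hyz
      have hst : insert z {a} ⊆ t := by
        intro w hw
        simp only [Finset.mem_insert, Finset.mem_singleton] at hw
        rcases hw with rfl | rfl <;> assumption
      have hcard : (insert z {a} : Finset V).card = 2 := by rw [Finset.card_insert_of_notMem hza]; simp
      generalize hs' : (insert z {a} : Finset V) = s at *
      have hsne : s.Nonempty := Finset.card_pos.1 (by omega)
      by_cases hout : ∀ z ∈ t, z ∉ s → (∀ x ∈ s, ¬ D.Adj z x) ∨ ∀ x ∈ s, ¬ D.Adj x z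
      · obtain ⟨x, hx, y, hy, hxs, hys, hne, hxy, h1, h2⟩ := exists_detour ht hD hst hsne
          (by rintro rfl; omega) hout
        have has : a ∈ s := by simp [← hs']
        refine ⟨insert x (insert y {a}), ?_, ?_, cutStrong_insert_detour (by simp) hxy
          (by simpa using h1 a has) (by simpa using h2 a has)⟩
        · intro z hz
          simp only [Finset.mem_insert, Finset.mem_singleton] at hz
          rcases hz with rfl | rfl | rfl <;> assumption
        · exact Finset.card_eq_three.2 ⟨x, y, a, hne, fun h => hxs (h ▸ has),
            fun h => hys (h ▸ has), rfl⟩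
      · push Not at hout
        obtain ⟨z, hz, hza, ⟨x, hx, hzx⟩, ⟨y, hy, hyz⟩⟩ := hout
        exact ⟨insert z s, Finset.insert_subset hz hst, by
          rw [Finset.card_insert_of_notMem hza, hcard], hs.insert_vertex hx hy hzx hyz⟩
  | succ k hk ih =>
    obtain ⟨s, hst, hcard, hs⟩ := ih (by omega)
    have hsne : s.Nonempty := Finset.card_pos.1 (by omega)
    by_cases hout : ∀ z ∈ t, z ∉ s → (∀ x ∈ s, ¬ D.Adj z x) ∨ ∀ x ∈ s, ¬ D.Adj x z
    · obtain ⟨x, hx, y, hy, hxs, hys, hne, hxy, h1, h2⟩ := exists_detour ht hD hst hsne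
        (by rintro rfl; omega) hout
      obtain ⟨c, hc⟩ := hsne
      -- The detour adds two vertices; dropping c makes the net gain one.
      refine ⟨insert x (insert y (s.erase c)), ?_, ?_, cutStrong_insert_detour ?_ hxy
        (fun d hd => h1 d (Finset.mem_of_mem_erase hd))
        (fun d hd => h2 d (Finset.mem_of_mem_erase hd))⟩
      · exact Finset.insert_subset hx (Finset.insert_subset hy
          ((Finset.erase_subset _ _).trans hst))
      · rw [Finset.card_insert_of_notMem, Finset.card_insert_of_notMem, Finset.card_erase_of_mem hc]
        · omega
        · simp [hys]
        · simp [hne, hxs]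
      · rw [← Finset.card_pos, Finset.card_erase_of_mem hc]; omega
    · push Not at hout
      obtain ⟨z, hz, hza, ⟨x, hx, hzx⟩, ⟨y, hy, hyz⟩⟩ := hout
      exact ⟨insert z s, Finset.insert_subset hz hst, by
        rw [Finset.card_insert_of_notMem hza, hcard], hs.insert_vertex hx hy hzx hyz⟩

end Growth

/-! ### Hamiltonian paths and closed walks. -/

/-- Insertion as in insertion sort: v goes just before the first vertex of `l` to which it sends an
arc, or at the end. -/
theorem exists_isChain_cons_perm {V : Type*} {D : Digraph V} {v : V} : ∀ (l : List V) (x : V), (x :: l).IsChain D.Adj →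
    D.Adj x v → (∀ y ∈ l, D.Adj v y ∨ D.Adj y v) →
    ∃ l', l'.Perm (v :: l) ∧ (x :: l').IsChain D.Adj
  | [], x, _, hxv, _ => ⟨[v], List.Perm.refl _, by simpa using hxv⟩
  | y :: l, x, hl, hxv, h => by
    rw [List.isChain_cons_cons] at hl
    rcases h y (by simp) with hvy | hyv
    · exact ⟨v :: y :: l, List.Perm.refl _, by
        simp only [List.isChain_cons_cons]; exact ⟨hxv, hvy, hl.2⟩⟩
    · obtain ⟨l', hp, hc⟩ := exists_isChain_cons_perm l y hl.2 hyv
        (fun z hz => h z (List.mem_cons_of_mem _ hz))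
      refine ⟨y :: l', (hp.cons y).trans (List.Perm.swap v y l), ?_⟩
      rw [List.isChain_cons_cons]
      exact ⟨hl.1, hc⟩

section HamiltonianPath

variable {V : Type*} [DecidableEq V] {D : Digraph V}

/-- A semicomplete digraph has a Hamiltonian path. -/
theorem SemicompleteOn.exists_isChain {s : Finset V} (h : SemicompleteOn D s) :
    ∃ l : List V, l.Nodup ∧ l.toFinset = s ∧ l.IsChain D.Adj := by
  induction s using Finset.induction_on with
  | empty => exact ⟨[], by simp⟩
  | @insert v s hv ih =>
    obtain ⟨l, hnd, hls, hc⟩ := ih (h.mono (Finset.subset_insert v s))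
    have hvl : v ∉ l := by rwa [← hls, List.mem_toFinset] at hv
    have hdir : ∀ y ∈ l, D.Adj v y ∨ D.Adj y v := by
      intro y hy
      refine h v (by simp) y ?_ (fun e => hvl (e ▸ hy))
      rw [← hls]; simp [hy]
    suffices ∃ l' : List V, l'.Perm (v :: l) ∧ l'.IsChain D.Adj by
      obtain ⟨l', hp, hc'⟩ := this
      refine ⟨l', hp.nodup_iff.2 (List.nodup_cons.2 ⟨hvl, hnd⟩), ?_, hc'⟩
      rw [List.toFinset_eq_of_perm _ _ hp, List.toFinset_cons, hls]
    cases l with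
    | nil => exact ⟨[v], List.Perm.refl _, by simp⟩
    | cons x l =>
      rcases hdir x (by simp) with hvx | hxv
      · exact ⟨v :: x :: l, List.Perm.refl _, by rw [List.isChain_cons_cons]; exact ⟨hvx, hc⟩⟩
      · obtain ⟨l', hp, hc'⟩ := exists_isChain_cons_perm l x hc hxv
          (fun y hy => hdir y (List.mem_cons_of_mem _ hy))
        exact ⟨x :: l', (hp.cons x).trans (List.Perm.swap v x l), hc'⟩

/-- The vertex set of a closed walk is strong. -/
theorem cutStrong_of_isChain {v w : V} {l : List V} (hc : (v :: (l ++ [w])).IsChain D.Adj)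
    (hw : D.Adj w v) : CutStrong D (v :: (l ++ [w])).toFinset := by
  intro A ⟨a, ha, haA⟩ ⟨b, hb, hbA⟩
  by_contra! hcon
  have key : ∀ x ∈ (v :: (l ++ [w])), x ∈ A → ∀ y ∈ (v :: (l ++ [w])), D.Adj x y → y ∈ A := by
    intro x hx hxA y hy hxy
    by_contra hyA
    exact hcon x (List.mem_toFinset.2 hx) hxA y (List.mem_toFinset.2 hy) hyA hxy
  -- A set left by no arc that meets the walk contains all later vertices, hence `w`, hence `v`,
  -- hence the whole walk.
  have step : ∀ (m m' : List V) (x : V), (v :: (l ++ [w])) = m ++ x :: m' → x ∈ A →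
      ∀ y ∈ x :: m', y ∈ A := by
    intro m m'
    induction m' generalizing m with
    | nil => intro x _ hx y hy; simp at hy; exact hy ▸ hx
    | cons z m' ih =>
      intro x he hx y hy
      rcases List.mem_cons.1 hy with rfl | hy
      · exact hx
      · have hxz : D.Adj x z := by
          rw [he] at hc
          have := (List.isChain_append.1 hc).2.1
          exact (List.isChain_cons_cons.1 this).1
        exact ih (m ++ [x]) z (by rw [he]; simp)
          (key x (by rw [he]; simp) hx z (by rw [he]; simp) hxz) y hy
  obtain ⟨m, m', he⟩ := List.append_of_mem (List.mem_toFinset.1 ha)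
  have hwA : w ∈ A := by
    apply step m m' a he haA
    have h1 : (v :: (l ++ [w])).getLast? = some w := by
      rw [← List.cons_append, List.getLast?_append]; simp
    rw [he, List.getLast?_append] at h1
    have h2 : (a :: m').getLast? = some w := by
      rcases h3 : (a :: m').getLast? with _ | u
      · simp at h3
      · simpa [h3] using h1
    exact List.mem_of_getLast? h2
  have hvA : v ∈ A := key w (by simp) hwA v (by simp) hw
  exact hbA (step [] (l ++ [w]) v rfl hvA b (List.mem_toFinset.1 hb))

end HamiltonianPath

/-! ### Counting the out-neighbourhoods of a vertex in a clique. -/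

/-- `X` is the set of out-neighbours in `N` of the vertex `v` in some semicomplete digraph on
`insert v N` which agrees with `σ` on `N` and has no strong subset of size `k`. -/
def IsFreePattern {V : Type*} [DecidableEq V] (k : ℕ) (σ : Digraph V) (N : Finset V) (v : V)
    (X : Finset V) : Prop :=
  X ⊆ N ∧ ∃ D : Digraph V, SemicompleteOn D (insert v N) ∧
    (∀ s ⊆ insert v N, s.card = k → ¬ CutStrong D s) ∧
    (∀ a ∈ N, ∀ b ∈ N, (D.Adj a b ↔ σ.Adj a b)) ∧ ∀ w ∈ N, (w ∈ X ↔ D.Adj v w)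

section Patterns

variable {V : Type*} [DecidableEq V] {k : ℕ} {σ : Digraph V} {N : Finset V} {v : V}

theorem IsFreePattern.mono {X M : Finset V} (h : IsFreePattern k σ N v X) (hM : M ⊆ N)
    (hX : X ⊆ M) : IsFreePattern k σ M v X := by
  obtain ⟨_, D, h1, h2, h3, h4⟩ := h
  have hs : insert v M ⊆ insert v N := Finset.insert_subset_insert v hM
  exact ⟨hX, D, h1.mono hs, fun s hs' => h2 s (hs'.trans hs),
    fun a ha b hb => h3 a (hM ha) b (hM hb), fun w hw => h4 w (hM hw)⟩

theorem IsFreePattern.semicompleteOn {X : Finset V} (h : IsFreePattern k σ N v X) :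
    SemicompleteOn σ N := by
  obtain ⟨_, D, h1, _, h3, _⟩ := h
  intro a ha b hb hab
  rw [← h3 a ha b hb, ← h3 b hb a ha]
  exact h1 a (by simp [ha]) b (by simp [hb]) hab

/-- If `v` sends an arc to the first vertex of a path, then it also sends an arc to every vertex
which comes late on the path. -/
theorem IsFreePattern.mem_of_mem_drop {j : ℕ} {X : Finset V}
    (h : IsFreePattern (j + 3) σ N v X) (hv : v ∉ N) {a : V} {l : List V} (hnd : (a :: l).Nodup)
    (hl : (a :: l).toFinset = N) (hc : (a :: l).IsChain σ.Adj) (ha : a ∈ X) {w : V}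
    (hw : w ∈ l.drop j) : w ∈ X := by
  obtain ⟨hXN, D, h1, h2, h3, h4⟩ := h
  by_contra hwX
  have hmem : ∀ x, x ∈ a :: l → x ∈ N := fun x hx => by rw [← hl]; exact List.mem_toFinset.2 hx
  have hwN : w ∈ N := hmem w (List.mem_cons_of_mem _ (List.mem_of_mem_drop hw))
  have hwv : D.Adj w v := by
    rcases h1 v (by simp) w (by simp [hwN]) (fun e => hv (e ▸ hwN)) with h | h
    · exact absurd ((h4 w hwN).2 h) hwX
    · exact h
  have hva : D.Adj v a := (h4 a (hXN ha)).1 ha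
  obtain ⟨m, m', he⟩ := List.append_of_mem hw
  have hle : a :: l = ((a :: (l.take j ++ m)) ++ [w]) ++ m' := by
    conv_lhs => rw [← List.take_append_drop j l, he]
    simp
  have hlen : j ≤ l.length := by
    by_contra hlt
    rw [List.drop_of_length_le (by omega)] at hw
    simp at hw
  have hcD : (a :: l).IsChain D.Adj := by
    refine hc.imp_of_mem_imp ?_
    intro x y hx hy hxy
    exact (h3 x (hmem x hx) y (hmem y hy)).2 hxy
  have hc1 : ((a :: (l.take j ++ m)) ++ [w]).IsChain D.Adj := by
    rw [hle] at hcD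
    exact (List.isChain_append.1 hcD).1
  have hc2 : (v :: ((a :: (l.take j ++ m)) ++ [w])).IsChain D.Adj := by
    rw [List.cons_append] at hc1 ⊢
    exact List.isChain_cons_cons.2 ⟨hva, hc1⟩
  have hstrong := cutStrong_of_isChain hc2 hwv
  have hsubN : ((a :: (l.take j ++ m)) ++ [w]).toFinset ⊆ N := by
    intro x hx
    apply hmem
    rw [hle]
    exact List.mem_append_left _ (List.mem_toFinset.1 hx)
  have hsub : (v :: ((a :: (l.take j ++ m)) ++ [w])).toFinset ⊆ insert v N := by
    rw [List.toFinset_cons]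
    exact Finset.insert_subset_insert v hsubN
  have hnd' : (v :: ((a :: (l.take j ++ m)) ++ [w])).Nodup := by
    rw [List.nodup_cons]
    refine ⟨fun hx => hv (hsubN (List.mem_toFinset.2 hx)), ?_⟩
    rw [hle] at hnd
    exact (List.nodup_append.1 hnd).1
  -- The cycle v → a → ... → w → v contains v, a, w and the first j vertices of `l`.
  have hcard : j + 3 ≤ (v :: ((a :: (l.take j ++ m)) ++ [w])).toFinset.card := by
    rw [List.toFinset_card_of_nodup hnd']
    simp only [List.length_cons, List.length_append, List.length_take, List.length_nil]
    omega
  obtain ⟨s, hs, hsc, hss⟩ := hstrong.exists_subset_card_eq (h1.mono hsub)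
    (by omega : 3 ≤ j + 3) hcard
  exact h2 s (hs.trans hsub) hsc hss

/-- The number of free patterns from a vertex to a clique. -/
theorem card_freePatterns_le {j e : ℕ} (hv : v ∉ N) (hN : N.card = j + 1 + e)
    (F : Finset (Finset V)) (hF : ∀ X ∈ F, IsFreePattern (j + 3) σ N v X) :
    F.card ≤ 2 ^ j * (e + 2) := by
  induction e generalizing N F with
  | zero =>
    calc F.card ≤ N.powerset.card :=
          Finset.card_le_card fun X hX => Finset.mem_powerset.2 (hF X hX).1
      _ = 2 ^ j * (0 + 2) := by rw [Finset.card_powerset, hN, pow_succ]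
  | succ e ih =>
    rcases F.eq_empty_or_nonempty with rfl | ⟨X₀, hX₀⟩
    · simp
    obtain ⟨l, hnd, hl, hc⟩ := (hF X₀ hX₀).semicompleteOn.exists_isChain
    cases l with
    | nil => simp at hl; rw [← hl] at hN; simp at hN
    | cons a l =>
      have haN : a ∈ N := by rw [← hl]; simp
      -- Patterns avoiding the first path vertex are patterns on `N.erase a`; those containing it
      -- are determined by their trace on the next j vertices of the path.
      have h1 : (F.filter (a ∉ ·)).card ≤ 2 ^ j * (e + 2) := by
        refine ih (N := N.erase a) (fun h => hv (Finset.mem_of_mem_erase h)) ?_ _ ?_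
        · rw [Finset.card_erase_of_mem haN]; omega
        · intro X hX
          obtain ⟨hX, haX⟩ := Finset.mem_filter.1 hX
          exact (hF X hX).mono (Finset.erase_subset _ _) (Finset.subset_erase.2 ⟨(hF X hX).1, haX⟩)
      have h2 : (F.filter (a ∈ ·)).card ≤ 2 ^ j := by
        calc (F.filter (a ∈ ·)).card ≤ ((l.take j).toFinset.powerset).card := by
              refine Finset.card_le_card_of_injOn (fun X => X ∩ (l.take j).toFinset) ?_ ?_
              · intro X _
                simp
              · intro X hX Y hY hXY
                simp only [Finset.coe_filter, Set.mem_ofPred_eq] at hX hY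
                have key : ∀ w, w ∈ N → (w ∈ X ↔ w ∈ Y) := by
                  intro w hw
                  rw [← hl, List.mem_toFinset, List.mem_cons] at hw
                  rcases hw with rfl | hw
                  · simp [hX.2, hY.2]
                  · rw [← List.take_append_drop j l, List.mem_append] at hw
                    rcases hw with hw | hw
                    · have := Finset.ext_iff.1 hXY w
                      simpa [hw] using this
                    · simp [(hF X hX.1).mem_of_mem_drop hv hnd hl hc hX.2 hw,
                        (hF Y hY.1).mem_of_mem_drop hv hnd hl hc hY.2 hw]
                ext w
                exact ⟨fun h => (key w ((hF X hX.1).1 h)).1 h,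
                  fun h => (key w ((hF Y hY.1).1 h)).2 h⟩
          _ ≤ 2 ^ j := by
              rw [Finset.card_powerset]
              refine Nat.pow_le_pow_right (by norm_num) ?_
              exact (List.toFinset_card_le _).trans (by simp)
      have h3 := Finset.card_filter_add_card_filter_not (s := F) (a ∈ ·)
      have : 2 ^ j * (e + 1 + 2) = 2 ^ j * (e + 2) + 2 ^ j := by ring
      omega

/-- A vertex adjacent to all vertices of a strong set of size `k - 1` is a source or a sink. -/
theorem card_freePatterns_le_two (hv : v ∉ N) (hN : N.card + 1 = k) (hσ : CutStrong σ N)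
    (F : Finset (Finset V)) (hF : ∀ X ∈ F, IsFreePattern k σ N v X) : F.card ≤ 2 := by
  have : F ⊆ {∅, N} := by
    intro X hX
    obtain ⟨hXN, D, h1, h2, h3, h4⟩ := hF X hX
    simp only [Finset.mem_insert, Finset.mem_singleton]
    by_contra! hne
    obtain ⟨x, hx⟩ := hne.1
    obtain ⟨y, hyN, hyX⟩ : ∃ y ∈ N, y ∉ X := by
      by_contra! h
      exact hne.2 (Finset.Subset.antisymm hXN h)
    have hyv : D.Adj y v := by
      rcases h1 v (by simp) y (by simp [hyN]) (fun e => hv (e ▸ hyN)) with h | h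
      · exact absurd ((h4 y hyN).2 h) hyX
      · exact h
    have hD : CutStrong D N := by
      intro A hA hA'
      obtain ⟨a, ha, haA, b, hb, hbA, hab⟩ := hσ A hA hA'
      exact ⟨a, ha, haA, b, hb, hbA, (h3 a ha b hb).2 hab⟩
    exact h2 (insert v N) (Finset.Subset.refl _) (by rw [Finset.card_insert_of_notMem hv, hN])
      (hD.insert_vertex (hXN hx) hyN ((h4 x (hXN hx)).1 hx) hyv)
  exact (Finset.card_le_card this).trans Finset.card_le_two

end Patterns

/-! ### Restriction to induced subgraphs and invariance under isomorphism. -/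

instance Digraph.finite_of_finite {V : Type*} [Finite V] : Finite (Digraph V) :=
  Finite.of_injective _ Digraph.adj_injective

/-- The digraph on `U` obtained from `D` by pulling the arcs back along `f`. -/
def Digraph.pullback {U V : Type*} (f : U → V) (D : Digraph V) : Digraph U :=
  ⟨fun a b => D.Adj (f a) (f b)⟩

section Pullback

variable {U V : Type*} {G : SimpleGraph V} {D : Digraph V} {k : ℕ}

theorem mem_freeOrientations_iff : D ∈ freeOrientations k G ↔
    IsOrientation G D ∧ ∀ s : Finset V, G.IsNClique k s → ¬ CutStrong D s := by
  simp only [freeOrientations, Set.mem_ofPred_eq, stronglyConnectedOn_iff_cutStrong]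

theorem CutStrong.map {f : U ↪ V} {s : Finset U} (h : CutStrong (D.pullback f) s) :
    CutStrong D (s.map f) := by
  rintro A ⟨a, ha, haA⟩ ⟨b, hb, hbA⟩
  obtain ⟨a, ha', rfl⟩ := Finset.mem_map.1 ha
  obtain ⟨b, hb', rfl⟩ := Finset.mem_map.1 hb
  obtain ⟨x, hx, hxA, y, hy, hyA, hxy⟩ := h (f ⁻¹' A) ⟨a, ha', haA⟩ ⟨b, hb', hbA⟩
  exact ⟨f x, Finset.mem_map_of_mem f hx, hxA, f y, Finset.mem_map_of_mem f hy, hyA, hxy⟩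

theorem pullback_mem_freeOrientations (f : U ↪ V) (hD : D ∈ freeOrientations k G) :
    D.pullback f ∈ freeOrientations k (G.comap f) := by
  rw [mem_freeOrientations_iff] at hD ⊢
  refine ⟨⟨fun u v => hD.1.1 (f u) (f v), fun u v => hD.1.2 (f u) (f v)⟩, ?_⟩
  intro s hs hstrong
  refine hD.2 (s.map f) ?_ hstrong.map
  rw [SimpleGraph.isNClique_iff] at hs ⊢
  refine ⟨?_, by simpa using hs.2⟩
  intro x hx y hy hxy
  simp only [Finset.coe_map, Set.mem_image, Finset.mem_coe] at hx hy
  obtain ⟨a, ha, rfl⟩ := hx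
  obtain ⟨b, hb, rfl⟩ := hy
  exact hs.1 ha hb (fun e => hxy (e ▸ rfl))

theorem numFreeOrientations_le_of_iso [Finite U] {H : SimpleGraph U} (e : H ≃g G) :
    numFreeOrientations k G ≤ numFreeOrientations k H := by
  have hH : G.comap e.toEquiv.toEmbedding = H := by
    ext a b
    exact e.map_adj_iff
  refine Set.ncard_le_ncard_of_injOn (Digraph.pullback e) ?_ ?_ (Set.toFinite _)
  · intro D hD
    have := pullback_mem_freeOrientations e.toEquiv.toEmbedding hD
    rwa [hH] at this
  · intro D _ D' _ h
    ext a b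
    have := congrArg (fun K : Digraph U => K.Adj (e.symm a) (e.symm b)) h
    simpa [Digraph.pullback] using this

theorem numFreeOrientations_congr [Finite U] [Finite V] {H : SimpleGraph U} (e : H ≃g G) :
    numFreeOrientations k H = numFreeOrientations k G :=
  le_antisymm (numFreeOrientations_le_of_iso e.symm) (numFreeOrientations_le_of_iso e)

end Pullback

/-! ### The number of all orientations. -/

section Orientations

/-- The orientation of `G` in which the edges in `S` point upwards and the others downwards. -/
def orientationOfEdges {V : Type*} [LinearOrder V] (G : SimpleGraph V) (S : Finset (Sym2 V)) :
    Digraph V :=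
  ⟨fun a b => G.Adj a b ∧ (a < b ↔ s(a, b) ∈ S)⟩

theorem ncard_orientations_of_linearOrder {V : Type*} [LinearOrder V] (G : SimpleGraph V)
    [Fintype G.edgeSet] : {D | IsOrientation G D}.ncard = 2 ^ G.edgeFinset.card := by
  rw [← Finset.card_powerset, ← Set.ncard_coe_finset]
  symm
  refine Set.ncard_congr (fun S _ => orientationOfEdges G S) ?_ ?_ ?_
  · intro S _
    constructor
    · intro u v
      simp only [orientationOfEdges, G.adj_comm v u, Sym2.eq_swap (a := v) (b := u)]
      refine ⟨fun h => ?_, fun h => by tauto⟩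
      rcases lt_trichotomy u v with hlt | rfl | hlt
      · have := hlt.not_gt
        tauto
      · exact absurd h (G.irrefl)
      · have := hlt.not_gt
        tauto
    · rintro u v ⟨h1, h2⟩ ⟨_, h3⟩
      rw [Sym2.eq_swap] at h3
      rcases lt_trichotomy u v with hlt | rfl | hlt
      · have := hlt.not_gt
        tauto
      · exact absurd h1 (G.irrefl)
      · have := hlt.not_gt
        tauto
  · intro S T hS hT h
    simp only [Finset.coe_powerset, Set.mem_preimage, Set.mem_powerset_iff, Finset.coe_subset]
      at hS hT
    ext e
    induction e using Sym2.ind with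
    | _ a b =>
    by_cases hab : G.Adj a b
    · have := congrArg (fun K : Digraph V => K.Adj a b) h
      simp only [orientationOfEdges, hab, true_and, eq_iff_iff] at this
      tauto
    · have h1 : s(a, b) ∉ S := fun h => hab (by simpa using hS h)
      have h2 : s(a, b) ∉ T := fun h => hab (by simpa using hT h)
      simp [h1, h2]
  · intro D hD
    classical
    refine ⟨G.edgeFinset.filter (fun e => ∃ a b, a < b ∧ e = s(a, b) ∧ D.Adj a b), by simp, ?_⟩
    ext a b
    simp only [orientationOfEdges, Finset.mem_filter, SimpleGraph.mem_edgeFinset,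
      SimpleGraph.mem_edgeSet]
    have h1 := hD.1 a b
    have h2 := hD.2 a b
    constructor
    · rintro ⟨hab, h⟩
      rcases lt_trichotomy a b with hlt | rfl | hlt
      · obtain ⟨_, x, y, hxy, he, hD⟩ := h.1 hlt
        rcases Sym2.eq_iff.1 he with ⟨rfl, rfl⟩ | ⟨rfl, rfl⟩
        · exact hD
        · exact absurd hlt hxy.not_gt
      · exact absurd hab (G.irrefl)
      · rcases h1.1 hab with h' | h'
        · exact h'
        · exact absurd (h.2 ⟨hab, b, a, hlt, Sym2.eq_swap, h'⟩) hlt.not_gt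
    · intro h
      refine ⟨h1.2 (Or.inl h), fun hlt => ⟨h1.2 (Or.inl h), a, b, hlt, rfl, h⟩, ?_⟩
      rintro ⟨_, x, y, hxy, he, hD⟩
      rcases Sym2.eq_iff.1 he with ⟨rfl, rfl⟩ | ⟨rfl, rfl⟩
      · exact hxy
      · exact absurd hD (h2 h)

theorem ncard_orientations {V : Type*} (G : SimpleGraph V) [Fintype G.edgeSet] :
    {D | IsOrientation G D}.ncard = 2 ^ G.edgeFinset.card := by
  -- Any linear order serves: it only fixes a reference direction for each edge.
  let _ : LinearOrder V := IsWellOrder.linearOrder WellOrderingRel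
  exact ncard_orientations_of_linearOrder G

theorem numFreeOrientations_le_two_pow {V : Type*} [Finite V] (k : ℕ) (G : SimpleGraph V)
    [Fintype G.edgeSet] : numFreeOrientations k G ≤ 2 ^ G.edgeFinset.card := by
  rw [← ncard_orientations]
  exact Set.ncard_le_ncard (fun D hD => hD.1) (Set.toFinite _)

theorem numFreeOrientations_of_cliqueFree {V : Type*} {k : ℕ} {G : SimpleGraph V}
    [Fintype G.edgeSet] (h : G.CliqueFree k) :
    numFreeOrientations k G = 2 ^ G.edgeFinset.card := by
  rw [← ncard_orientations]
  exact congrArg Set.ncard (Set.ext fun D => ⟨fun hD => hD.1, fun hD => ⟨hD, fun s hs => absurd hs (h s)⟩⟩)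

end Orientations

/-! ### Decomposing a free orientation along a vertex set. -/

/-- Extension of a digraph on `W` by isolated vertices. -/
def extendDigraph {V : Type*} {W : Finset V} (σ : Digraph {x // x ∈ W}) : Digraph V :=
  ⟨fun a b => ∃ (ha : a ∈ W) (hb : b ∈ W), σ.Adj ⟨a, ha⟩ ⟨b, hb⟩⟩

theorem cutStrong_extendDigraph {V : Type*} {W : Finset V} {σ : Digraph {x // x ∈ W}}
    (h : CutStrong σ Finset.univ) : CutStrong (extendDigraph σ) W := by
  intro A ⟨a, ha, haA⟩ ⟨b, hb, hbA⟩
  obtain ⟨x, _, hxA, y, _, hyA, hxy⟩ := h (Subtype.val ⁻¹' A) ⟨⟨a, ha⟩, by simp, haA⟩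
    ⟨⟨b, hb⟩, by simp, hbA⟩
  exact ⟨x, x.2, hxA, y, y.2, hyA, x.2, y.2, hxy⟩

section Counting

variable {V : Type*} [Fintype V] [DecidableEq V]

/-- The free orientations, as a finset. -/
noncomputable def freeFinset {V : Type*} [Finite V] (k : ℕ) (G : SimpleGraph V) :
    Finset (Digraph V) :=
  (Set.toFinite (freeOrientations k G)).toFinset

theorem mem_freeFinset {V : Type*} [Finite V] {k : ℕ} {G : SimpleGraph V} {D : Digraph V} :
    D ∈ freeFinset k G ↔ D ∈ freeOrientations k G := by
  simp [freeFinset]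

theorem card_freeFinset {V : Type*} [Finite V] (k : ℕ) (G : SimpleGraph V) :
    (freeFinset k G).card = numFreeOrientations k G :=
  (Set.ncard_eq_toFinset_card _ _).symm

open Classical in
/-- The possible out-neighbourhoods in `W` of `v` over all free orientations extending `σ`. -/
noncomputable def patterns (k : ℕ) (G : SimpleGraph V) (W : Finset V)
    (σ : Digraph {x // x ∈ W}) (v : V) : Finset (Finset V) :=
  W.powerset.filter fun X => ∃ D ∈ freeOrientations k G,
    D.pullback (Subtype.val : {x // x ∈ W} → V) = σ ∧ ∀ w ∈ W, (w ∈ X ↔ D.Adj v w)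

open Classical in
/-- A free orientation is determined by its restrictions to `W` and to the complement of `W`,
and by the out-neighbourhoods in `W` of the vertices outside `W`. -/
theorem numFreeOrientations_le_sum_prod (k : ℕ) (G : SimpleGraph V) (W : Finset V) :
    numFreeOrientations k G ≤
      (∑ σ ∈ freeFinset k (G.comap (Subtype.val : {x // x ∈ W} → V)),
        ∏ v : {x // x ∉ W}, (patterns k G W σ v).card) *
      numFreeOrientations k (G.comap (Subtype.val : {x // x ∉ W} → V)) := by
  have hcard : ((∑ σ ∈ freeFinset k (G.comap (Subtype.val : {x // x ∈ W} → V)),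
        ∏ v : {x // x ∉ W}, (patterns k G W σ v).card) *
      numFreeOrientations k (G.comap (Subtype.val : {x // x ∉ W} → V))) =
      (((freeFinset k (G.comap (Subtype.val : {x // x ∈ W} → V))).sigma
        fun σ => Fintype.piFinset fun v : {x // x ∉ W} => patterns k G W σ v) ×ˢ
        freeFinset k (G.comap (Subtype.val : {x // x ∉ W} → V))).card := by
    rw [Finset.card_product, Finset.card_sigma, card_freeFinset]
    simp only [Fintype.card_piFinset]
  rw [hcard, ← card_freeFinset]
  refine Finset.card_le_card_of_injOn (fun D => (⟨D.pullback Subtype.val,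
    fun v => W.filter (D.Adj v)⟩, D.pullback Subtype.val)) ?_ ?_
  · intro D hD
    have hD := mem_freeFinset.1 hD
    simp only [Finset.coe_product, Set.mem_prod, Finset.mem_coe, Finset.mem_sigma,
      Fintype.mem_piFinset, mem_freeFinset]
    refine ⟨⟨pullback_mem_freeOrientations (Function.Embedding.subtype _) hD, fun v => ?_⟩,
      pullback_mem_freeOrientations (Function.Embedding.subtype _) hD⟩
    refine Finset.mem_filter.2 ⟨by simp, D, hD, rfl, fun w hw => by simp [hw]⟩
  · intro D hD D' hD' h
    have hD := (mem_freeFinset.1 hD).1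
    have hD' := (mem_freeFinset.1 hD').1
    simp only [Prod.mk.injEq, Sigma.mk.injEq] at h
    obtain ⟨⟨h1, h2⟩, h3⟩ := h
    have h2 := eq_of_heq h2
    have hvw : ∀ v w, v ∉ W → w ∈ W → (D.Adj v w ↔ D'.Adj v w) := by
      intro v w hv hw
      have := Finset.ext_iff.1 (congrFun h2 ⟨v, hv⟩) w
      simpa [hw] using this
    ext a b
    by_cases ha : a ∈ W
    · by_cases hb : b ∈ W
      · exact Eq.to_iff (congrArg (fun K : Digraph {x // x ∈ W} => K.Adj ⟨a, ha⟩ ⟨b, hb⟩) h1)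
      · have e1 := hD.1 a b
        have e2 := hD.2 a b
        have e3 := hD'.1 a b
        have e4 := hD'.2 a b
        have e5 := hvw b a hb ha
        tauto
    · by_cases hb : b ∈ W
      · exact hvw a b ha hb
      · exact Eq.to_iff (congrArg (fun K : Digraph {x // x ∉ W} => K.Adj ⟨a, ha⟩ ⟨b, hb⟩) h3)

open Classical in
-- The vertex v and its neighbours in the clique `W` form a clique, so a free orientation realizing
-- `X` is itself the witness.
theorem isFreePattern_of_mem_patterns {k : ℕ} {G : SimpleGraph V} {W : Finset V}
    (hW : G.IsClique W) {σ : Digraph {x // x ∈ W}} {v : V} {X : Finset V}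
    (hX : X ∈ patterns k G W σ v) :
    IsFreePattern k (extendDigraph σ) (W.filter (G.Adj v)) v X := by
  obtain ⟨hXW, D, hD, rfl, hXD⟩ := Finset.mem_filter.1 hX
  rw [Finset.mem_powerset] at hXW
  have hD := mem_freeOrientations_iff.1 hD
  have hcl : G.IsClique (insert v (W.filter (G.Adj v)) : Finset V) := by
    rw [Finset.coe_insert]
    refine SimpleGraph.IsClique.insert (hW.subset (by exact_mod_cast Finset.filter_subset _ _)) ?_
    intro b hb _
    simp only [Finset.coe_filter, Set.mem_ofPred_eq] at hb
    exact hb.2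
  refine ⟨?_, D, ?_, ?_, ?_, ?_⟩
  · intro w hw
    exact Finset.mem_filter.2 ⟨hXW hw, (hD.1.1 v w).2 (Or.inl ((hXD w (hXW hw)).1 hw))⟩
  · intro a ha b hb hab
    exact (hD.1.1 a b).1 (hcl ha hb hab)
  · intro s hs hsk
    exact hD.2 s ((SimpleGraph.isNClique_iff _).2 ⟨hcl.subset (by exact_mod_cast hs), hsk⟩)
  · intro a ha b hb
    have ha := (Finset.mem_filter.1 ha).1
    have hb := (Finset.mem_filter.1 hb).1
    simp [extendDigraph, Digraph.pullback, ha, hb]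
  · intro w hw
    exact hXD w (Finset.mem_filter.1 hw).1

open Classical in
theorem card_patterns_le {j e : ℕ} {G : SimpleGraph V} {W : Finset V} (hW : G.IsClique W)
    (σ : Digraph {x // x ∈ W}) {v : V} (hv : v ∉ W)
    (hN : (W.filter (G.Adj v)).card ≤ j + 1 + e) :
    (patterns (j + 3) G W σ v).card ≤ 2 ^ j * (e + 2) := by
  by_cases h : j + 1 ≤ (W.filter (G.Adj v)).card
  · obtain ⟨e', he'⟩ := Nat.exists_eq_add_of_le h
    refine (card_freePatterns_le (fun hv' => hv (Finset.mem_filter.1 hv').1) he' _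
      (fun X hX => isFreePattern_of_mem_patterns hW hX)).trans ?_
    exact Nat.mul_le_mul_left _ (by omega)
  · calc (patterns (j + 3) G W σ v).card ≤ (W.filter (G.Adj v)).powerset.card :=
          Finset.card_le_card fun X hX =>
            Finset.mem_powerset.2 (isFreePattern_of_mem_patterns hW hX).1
      _ ≤ 2 ^ j := by
          rw [Finset.card_powerset]
          exact Nat.pow_le_pow_right (by norm_num) (by omega)
      _ ≤ 2 ^ j * (e + 2) := Nat.le_mul_of_pos_right _ (by omega)

theorem card_patterns_le_two {k : ℕ} {G : SimpleGraph V} {W : Finset V} (hW : G.IsClique W)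
    {σ : Digraph {x // x ∈ W}} (hσ : CutStrong σ Finset.univ) {v : V} (hv : v ∉ W)
    (hadj : ∀ w ∈ W, G.Adj v w) (hk : W.card + 1 = k) : (patterns k G W σ v).card ≤ 2 := by
  classical
  have hN : W.filter (G.Adj v) = W := Finset.filter_true_of_mem hadj
  refine card_freePatterns_le_two hv hk (cutStrong_extendDigraph hσ) _ fun X hX => ?_
  have := isFreePattern_of_mem_patterns hW hX
  rwa [hN] at this

end Counting

/-! ### Small graphs by evaluation of binary codes. -/

section Codes

/-- The direction of the pair `i, j` in the tournament coded by the binary digits of `t`. -/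
def arcOfCode {p : ℕ} (t : ℕ) (i j : Fin p) : Bool :=
  if i.val < j.val then t.testBit (j.val * (j.val - 1) / 2 + i.val)
  else if j.val < i.val then !t.testBit (i.val * (i.val - 1) / 2 + j.val)
  else false

/-- Whether the sequence `a, l, z` is a walk in the tournament coded by `t`. -/
def walkOfCode {p : ℕ} (t : ℕ) (z : Fin p) : Fin p → List (Fin p) → Bool
  | a, [] => arcOfCode t a z
  | a, b :: l => arcOfCode t a b && walkOfCode t z b l

/-- Whether no vertex set from the list `S` carries a Hamiltonian cycle in the tournament coded
by `t`. -/
def noCycleCode {p : ℕ} (S : List (Fin p × List (Fin p))) (t : ℕ) : Bool :=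
  S.all fun c => c.2.permutations'.all fun l => !walkOfCode t c.1 c.1 l

theorem isChain_of_walkOfCode {p t : ℕ} {D : Digraph (Fin p)} {s : Finset (Fin p)} {z : Fin p}
    (hz : z ∈ s) (h : ∀ x ∈ s, ∀ y ∈ s, arcOfCode t x y → D.Adj x y) (l : List (Fin p))
    (a : Fin p) (hl : (a :: l).toFinset ⊆ s) (hw : walkOfCode t z a l) :
    (a :: l).IsChain D.Adj ∧ D.Adj ((a :: l).getLast (by simp)) z := by
  induction l generalizing a with
  | nil =>
    refine ⟨by simp, ?_⟩
    exact h a (hl (by simp)) z hz hw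
  | cons b l ih =>
    simp only [walkOfCode, Bool.and_eq_true] at hw
    have := ih b (fun x hx => hl (by
      rw [List.toFinset_cons]; exact Finset.mem_insert_of_mem hx)) hw.2
    refine ⟨?_, ?_⟩
    · rw [List.isChain_cons_cons]
      exact ⟨h a (hl (by simp)) b (hl (by simp)) hw.1, this.1⟩
    · rw [List.getLast_cons (by simp)]
      exact this.2

theorem cutStrong_of_walkOfCode {p t : ℕ} {D : Digraph (Fin p)} {a : Fin p} {l : List (Fin p)}
    (h : ∀ x ∈ (a :: l).toFinset, ∀ y ∈ (a :: l).toFinset, arcOfCode t x y → D.Adj x y)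
    (hw : walkOfCode t a a l) : CutStrong D (a :: l).toFinset := by
  obtain ⟨h1, h2⟩ := isChain_of_walkOfCode (by simp) h l a (Finset.Subset.refl _) hw
  rcases l.eq_nil_or_concat with rfl | ⟨l', w, rfl⟩
  · simpa using cutStrong_singleton D a
  · simp only [List.concat_eq_append] at *
    refine cutStrong_of_isChain h1 ?_
    rw [List.getLast_cons (by simp)] at h2
    simpa using h2

open Classical in
/-- The code of an orientation, with respect to an enumeration `E` of the edges. -/
noncomputable def codeOf {p b : ℕ} (E : Fin b → Fin p × Fin p) (D : Digraph (Fin p)) : ℕ :=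
  Nat.ofBits fun e => decide (D.Adj (E e).1 (E e).2)

/-- `E` lists the edges of `G` in colexicographic order. -/
def IsColexEnum {p b : ℕ} (E : Fin b → Fin p × Fin p) (G : SimpleGraph (Fin p)) : Prop :=
  ∀ i j : Fin p, i.val < j.val → G.Adj i j →
    ∃ e : Fin b, E e = (i, j) ∧ e.val = j.val * (j.val - 1) / 2 + i.val

theorem testBit_codeOf {p b : ℕ} {E : Fin b → Fin p × Fin p} {G : SimpleGraph (Fin p)}
    (hE : IsColexEnum E G) (D : Digraph (Fin p)) {i j : Fin p} (hij : i.val < j.val)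
    (h : G.Adj i j) :
    (codeOf E D).testBit (j.val * (j.val - 1) / 2 + i.val) = true ↔ D.Adj i j := by
  obtain ⟨e, he, hei⟩ := hE i j hij h
  rw [← hei, codeOf, Nat.testBit_ofBits_lt _ _ e.2]
  simp [he]

theorem arcOfCode_codeOf {p b : ℕ} {E : Fin b → Fin p × Fin p} {G : SimpleGraph (Fin p)}
    (hE : IsColexEnum E G) {D : Digraph (Fin p)} (hD : IsOrientation G D) {i j : Fin p}
    (h : G.Adj i j) : arcOfCode (codeOf E D) i j = true ↔ D.Adj i j := by
  unfold arcOfCode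
  have h1 := hD.1 i j
  have h2 := hD.2 i j
  rcases lt_trichotomy i.val j.val with hlt | heq | hlt
  · rw [if_pos hlt, testBit_codeOf hE D hlt h]
  · exact absurd (Fin.ext heq) h.ne
  · rw [if_neg hlt.not_gt, if_pos hlt, Bool.not_eq_true', ← Bool.not_eq_true,
      testBit_codeOf hE D hlt h.symm]
    tauto

/-- A Hamiltonian cycle makes a clique strong. The converse is not needed for upper bounds, and the
start of the cycle may be fixed by rotation. -/
theorem noCycleCode_codeOf {p b k : ℕ} {E : Fin b → Fin p × Fin p} {G : SimpleGraph (Fin p)}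
    (hE : IsColexEnum E G) {D : Digraph (Fin p)} (hD : D ∈ freeOrientations k G)
    {S : List (Fin p × List (Fin p))} (hS : ∀ c ∈ S, G.IsNClique k (c.1 :: c.2).toFinset) :
    noCycleCode S (codeOf E D) = true := by
  have hD := mem_freeOrientations_iff.1 hD
  simp only [noCycleCode, List.all_eq_true]
  intro c hc l hl
  rw [Bool.not_eq_true', ← Bool.not_eq_true]
  intro hw
  have hp : (c.1 :: l).toFinset = (c.1 :: c.2).toFinset :=
    List.toFinset_eq_of_perm _ _ ((List.mem_permutations'.1 hl).cons c.1)
  have hcl := hS c hc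
  refine hD.2 _ hcl ?_
  rw [← hp]
  refine cutStrong_of_walkOfCode (fun x hx y hy hxy => ?_) hw
  rw [hp] at hx hy
  have hne : x ≠ y := by
    rintro rfl
    simp [arcOfCode] at hxy
  exact (arcOfCode_codeOf hE hD.1 (hcl.isClique hx hy hne)).1 hxy

theorem numFreeOrientations_le_count {p b k : ℕ} {E : Fin b → Fin p × Fin p}
    {G : SimpleGraph (Fin p)} (hE : IsColexEnum E G) {S : List (Fin p × List (Fin p))}
    (hS : ∀ c ∈ S, G.IsNClique k (c.1 :: c.2).toFinset) :
    numFreeOrientations k G ≤ Nat.count (fun t => noCycleCode S t = true) (2 ^ b) := by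
  rw [Nat.count_eq_card_filter_range, ← Set.ncard_coe_finset]
  refine Set.ncard_le_ncard_of_injOn (codeOf E) ?_ ?_ (Set.toFinite _)
  · intro D hD
    simp only [Finset.coe_filter, Finset.mem_range, Set.mem_ofPred_eq]
    exact ⟨Nat.ofBits_lt_two_pow _, noCycleCode_codeOf hE hD hS⟩
  · intro D hD D' hD' h
    ext i j
    have h1 := hD.1.1 i j
    have h2 := hD'.1.1 i j
    by_cases hij : G.Adj i j
    · rw [← arcOfCode_codeOf hE hD.1 hij, ← arcOfCode_codeOf hE hD'.1 hij, h]
    · tauto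

/-- The pairs from five vertices in colexicographic order. -/
def fivePairs : Fin 10 → Fin 5 × Fin 5 :=
  ![(0, 1), (0, 2), (1, 2), (0, 3), (1, 3), (2, 3), (0, 4), (1, 4), (2, 4), (3, 4)]

theorem isNClique_top_toFinset {V : Type*} [DecidableEq V] {k : ℕ} {l : List V} (hl : l.Nodup)
    (hk : l.length = k) : (⊤ : SimpleGraph V).IsNClique k l.toFinset :=
  (SimpleGraph.isNClique_iff _).2
    ⟨fun _ _ _ _ h => h, (List.toFinset_card_of_nodup hl).trans hk⟩

theorem isColexEnum_fivePairs : IsColexEnum fivePairs ⊤ := by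
  intro i j hij _
  revert i j
  decide

/-- Of the 1024 tournaments on five labelled vertices, 544 are strong. That 480 is less than half of
1024 starts the induction for k ≥ 5. -/
theorem numFreeOrientations_five_top_five :
    numFreeOrientations 5 (⊤ : SimpleGraph (Fin 5)) ≤ 480 :=
  (numFreeOrientations_le_count isColexEnum_fivePairs (S := [(0, [1, 2, 3, 4])]) (by
    intro c hc
    rw [List.mem_singleton] at hc
    subst hc
    exact isNClique_top_toFinset (by decide) rfl)).trans (by decide +kernel)

/-- For k = 4 the induction on complete graphs starts here, because 240 < 2^8 and t_3(5) = 8. -/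
theorem numFreeOrientations_four_top_five :
    numFreeOrientations 4 (⊤ : SimpleGraph (Fin 5)) ≤ 240 :=
  (numFreeOrientations_le_count isColexEnum_fivePairs
    (S := [(0, [1, 2, 3]), (0, [1, 2, 4]), (0, [1, 3, 4]), (0, [2, 3, 4]), (1, [2, 3, 4])]) (by
    intro c hc
    simp only [List.mem_cons, List.not_mem_nil, or_false] at hc
    rcases hc with rfl | rfl | rfl | rfl | rfl <;>
    exact isNClique_top_toFinset (by decide) rfl)).trans (by decide +kernel)

/-- The complete graph on five vertices without the edge joining the last two vertices. -/
def fiveMinusEdge : SimpleGraph (Fin 5) where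
  Adj i j := i ≠ j ∧ ¬ (3 ≤ i ∧ 3 ≤ j)
  symm := ⟨by intro i j h; exact ⟨h.1.symm, fun h' => h.2 h'.symm⟩⟩
  loopless := ⟨fun i h => h.1 rfl⟩

instance : DecidableRel fiveMinusEdge.Adj := fun i j =>
  inferInstanceAs (Decidable (i ≠ j ∧ ¬ (3 ≤ i ∧ 3 ≤ j)))

theorem numFreeOrientations_four_fiveMinusEdge :
    numFreeOrientations 4 fiveMinusEdge ≤ 224 := by
  -- The missing edge comes last in colexicographic order, so the first nine positions enumerate the
  -- graph.
  refine (numFreeOrientations_le_count (E := fun e : Fin 9 => fivePairs (e.castLE (by norm_num)))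
    (S := [(0, [1, 2, 3]), (0, [1, 2, 4])]) ?_ ?_).trans (by decide +kernel)
  · intro i j
    revert i j
    decide
  · intro c hc
    simp only [List.mem_cons, List.not_mem_nil, or_false] at hc
    rcases hc with rfl | rfl <;>
    exact (SimpleGraph.isNClique_iff _).2 ⟨by
      rw [SimpleGraph.isClique_iff, Set.Pairwise]; simp only [Finset.mem_coe]; decide, by decide⟩

theorem numFreeOrientations_four_top_four_le :
    numFreeOrientations 4 (⊤ : SimpleGraph (Fin 4)) ≤ 40 :=
  (numFreeOrientations_le_count
    (E := ![(0, 1), (0, 2), (1, 2), (0, 3), (1, 3), (2, 3)]) (by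
      intro i j hij _
      revert i j
      decide) (S := [(0, [1, 2, 3])]) (by
    intro c hc
    rw [List.mem_singleton] at hc
    subst hc
    exact isNClique_top_toFinset (by decide) rfl)).trans (by decide +kernel)

/-- Whether some proper nonempty vertex set is left by no arc in the tournament on four vertices
coded by `t`. -/
def hasClosedSet (t : ℕ) : Prop :=
  ∃ A : Fin 4 → Bool, (∃ i, A i = true) ∧ (∃ i, A i = false) ∧
    ∀ i j, A i = true → A j = false → arcOfCode t i j = false

instance : DecidablePred hasClosedSet := fun _ => inferInstanceAs (Decidable (∃ _, _))

theorem numFreeOrientations_four_top_four :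
    numFreeOrientations 4 (⊤ : SimpleGraph (Fin 4)) = 40 := by
  refine le_antisymm numFreeOrientations_four_top_four_le ?_
  -- For the lower bound, a closed vertex set certifies that a tournament is not strong.
  have h40 : 40 ≤ Nat.count hasClosedSet (2 ^ 6) := by decide +kernel
  refine h40.trans ?_
  rw [Nat.count_eq_card_filter_range, ← Set.ncard_coe_finset]
  refine Set.ncard_le_ncard_of_injOn (fun t => ⟨fun i j => arcOfCode t i j = true⟩) ?_ ?_
    (Set.toFinite _)
  · intro t ht
    simp only [Finset.coe_filter, Finset.mem_range, Set.mem_ofPred_eq] at ht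
    rw [mem_freeOrientations_iff]
    refine ⟨⟨fun i j => ?_, fun i j => ?_⟩, ?_⟩
    · rcases lt_trichotomy i.val j.val with hlt | heq | hlt
      · simp [arcOfCode, hlt, hlt.not_gt, SimpleGraph.top_adj, Fin.ext_iff, hlt.ne]
      · simp [arcOfCode, Fin.ext heq]
      · simp [arcOfCode, hlt, hlt.not_gt, SimpleGraph.top_adj, Fin.ext_iff, hlt.ne']
    · rcases lt_trichotomy i.val j.val with hlt | heq | hlt
      · simp [arcOfCode, hlt, hlt.not_gt]
      · simp [arcOfCode, heq]
      · simp [arcOfCode, hlt, hlt.not_gt]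
    · intro s hs hstrong
      have hs : s = Finset.univ := Finset.card_eq_iff_eq_univ s |>.1 (by simpa using hs.card_eq)
      subst hs
      obtain ⟨A, ⟨i, hi⟩, ⟨j, hj⟩, hA⟩ := ht.2
      obtain ⟨x, _, hx, y, _, hy, hxy⟩ := hstrong {x | A x = true} ⟨i, by simp, hi⟩
        ⟨j, by simp, by simp [hj]⟩
      simp only [Set.mem_ofPred_eq, Bool.not_eq_true] at hx hy
      simp [hA x y hx hy] at hxy
  · intro t ht t' ht' h
    simp only [Finset.coe_filter, Finset.mem_range, Set.mem_ofPred_eq] at ht ht'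
    have key : ∀ i j : Fin 4, arcOfCode t i j = arcOfCode t' i j := by
      intro i j
      have := congrArg (fun K : Digraph (Fin 4) => K.Adj i j) h
      simpa using this
    refine Nat.eq_of_testBit_eq fun e => ?_
    by_cases he : e < 6
    · have k1 := key 0 1
      have k2 := key 0 2
      have k3 := key 1 2
      have k4 := key 0 3
      have k5 := key 1 3
      have k6 := key 2 3
      simp [arcOfCode] at k1 k2 k3 k4 k5 k6
      interval_cases e <;> simp [*]
    · have h64 : 2 ^ 6 ≤ 2 ^ e := Nat.pow_le_pow_right (by norm_num) (by omega)
      rw [Nat.testBit_lt_two_pow (ht.1.trans_le h64), Nat.testBit_lt_two_pow (ht'.1.trans_le h64)]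

end Codes

/-! ### Arithmetic of Turán numbers. -/

section TuranEdges

theorem turanEdges_add (n r : ℕ) :
    turanEdges (n + r) r = turanEdges n r + n * (r - 1) + r.choose 2 :=
  SimpleGraph.card_edgeFinset_turanGraph_add

theorem turanEdges_of_le {n r : ℕ} (h : n ≤ r) : turanEdges n r = n.choose 2 := by
  have := SimpleGraph.card_edgeFinset_top_eq_card_choose_two (V := Fin n)
  rw [Fintype.card_fin] at this
  rw [turanEdges, ← this]
  congr! 1
  convert! rfl
  exact (SimpleGraph.turanGraph_eq_top.2 (Or.inr h)).symm

/-- A new vertex joins a smallest part, of size n / r, and is adjacent to all other vertices. -/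
theorem turanEdges_succ {r : ℕ} (hr : 0 < r) (n : ℕ) :
    turanEdges (n + 1) r + n / r = turanEdges n r + n := by
  induction n using Nat.strong_induction_on with
  | _ n ih =>
  rcases lt_or_ge n r with h | h
  · rw [turanEdges_of_le h, turanEdges_of_le h.le, Nat.div_eq_of_lt h, Nat.choose_succ_succ' n 1]
    simp [add_comm]
  · obtain ⟨m, rfl⟩ := Nat.exists_eq_add_of_le' h
    have h1 := ih m (by omega)
    have h2 := turanEdges_add m r
    have h3 := turanEdges_add (m + 1) r
    rw [show m + r + 1 = m + 1 + r by ring, h2, h3, Nat.add_div_right _ hr]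
    obtain ⟨p, rfl⟩ : ∃ p, r = p + 1 := ⟨r - 1, by omega⟩
    simp only [Nat.add_sub_cancel] at *
    linarith

/-- Closed form with quadratic main term and a correction from the remainder b. Allowing b = p + 1
spares a case when two remainders are added. -/
theorem two_mul_turanEdges (p a b : ℕ) (hb : b ≤ p + 1) :
    2 * ((p : ℤ) + 1) * turanEdges ((p + 1) * a + b) (p + 1) + b * (p + 1 - b) =
      p * ((p + 1) * a + b) ^ 2 := by
  have hch : ∀ n : ℕ, 2 * (n.choose 2 : ℤ) = n * (n - 1) := by
    intro n
    cases n with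
    | zero => simp
    | succ n =>
      have := Nat.triangle_succ n
      rw [Nat.choose_two_right]
      have h2 : 2 * ((n + 1) * (n + 1 - 1) / 2) = (n + 1) * (n + 1 - 1) :=
        Nat.mul_div_cancel' (Nat.even_mul_pred_self (n + 1)).two_dvd
      zify at h2
      push_cast at h2 ⊢
      simpa using h2
  induction a with
  | zero =>
    rw [Nat.mul_zero, Nat.zero_add, turanEdges_of_le hb]
    have := hch b
    push_cast
    linear_combination ((p : ℤ) + 1) * this
  | succ a ih =>
    rw [show (p + 1) * (a + 1) + b = ((p + 1) * a + b) + (p + 1) by ring, turanEdges_add]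
    have := hch (p + 1)
    push_cast at this ih ⊢
    linear_combination ih + ((p : ℤ) + 1) * this

/-- The quadratic main terms produce exactly the cross term. With remainders b and d, the surplus is
bd if b + d ≤ q and (q - b)(q - d) otherwise. -/
theorem turanEdges_superadd {q : ℕ} (hq : 0 < q) (m r : ℕ) :
    q * turanEdges m q + q * turanEdges r q + (q - 1) * (m * r) ≤ q * turanEdges (m + r) q := by
  obtain ⟨p, rfl⟩ : ∃ p, q = p + 1 := ⟨q - 1, by omega⟩
  have hm := two_mul_turanEdges p (m / (p + 1)) (m % (p + 1)) (Nat.mod_lt _ hq).le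
  have hr := two_mul_turanEdges p (r / (p + 1)) (r % (p + 1)) (Nat.mod_lt _ hq).le
  have hm' := Nat.div_add_mod m (p + 1)
  have hr' := Nat.div_add_mod r (p + 1)
  have hb := Nat.mod_lt m hq
  have hd := Nat.mod_lt r hq
  generalize m / (p + 1) = a at *
  generalize m % (p + 1) = b at *
  generalize r / (p + 1) = c at *
  generalize r % (p + 1) = d at *
  subst hm' hr'
  rcases le_or_gt (b + d) (p + 1) with h | h
  · have hs := two_mul_turanEdges p (a + c) (b + d) h
    rw [show (p + 1) * (a + c) + (b + d) = (p + 1) * a + b + ((p + 1) * c + d) by ring] at hs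
    zify at *
    simp only [Nat.add_sub_cancel]
    nlinarith [mul_nonneg (Int.natCast_nonneg b) (Int.natCast_nonneg d)]
  · obtain ⟨f, hf⟩ := Nat.exists_eq_add_of_lt h
    have hs := two_mul_turanEdges p (a + c + 1) (f + 1) (by omega)
    rw [show (p + 1) * (a + c + 1) + (f + 1) = (p + 1) * a + b + ((p + 1) * c + d) by
      linarith] at hs
    have h1 : (0 : ℤ) ≤ (p + 1 - b) * (p + 1 - d) :=
      mul_nonneg (by zify at hb; linarith) (by zify at hd; linarith)
    have h2 : (f : ℤ) = b + d - (p + 1) - 1 := by zify at hf; linarith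
    zify at *
    simp only [Nat.add_sub_cancel]
    rw [h2] at hs
    nlinarith

end TuranEdges

/-! ### Numerical inequalities. -/

section Estimates

/-- This is where k ≥ 4 enters: for q = 2 and e = 1 it would read 9 ≤ 8. -/
theorem add_two_pow_le {q e : ℕ} (hq : 3 ≤ q) (he : 1 ≤ e) :
    (e + 2) ^ q ≤ 2 ^ (q + (q - 1) * e) := by
  induction q, hq using Nat.le_induction with
  | base =>
    induction e, he using Nat.le_induction with
    | base => norm_num
    | succ e he ih =>
      have : 2 ^ (3 + (3 - 1) * (e + 1)) = 4 * 2 ^ (3 + (3 - 1) * e) := by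
        rw [show 3 + (3 - 1) * (e + 1) = 2 + (3 + (3 - 1) * e) by omega, pow_add]; norm_num
      rw [this]
      obtain ⟨f, rfl⟩ := Nat.exists_eq_add_of_le' he
      have h2 : (f + 1 + 1 + 2) ^ 3 + (3 * f ^ 3 + 24 * f ^ 2 + 60 * f + 44) =
          4 * (f + 1 + 2) ^ 3 := by ring
      omega
  | succ q hq ih =>
    have h1 : e + 2 ≤ 2 ^ (1 + e) := by
      have := Nat.lt_two_pow_self (n := e)
      rw [pow_add]; omega
    calc (e + 2) ^ (q + 1) = (e + 2) ^ q * (e + 2) := pow_succ _ _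
      _ ≤ 2 ^ (q + (q - 1) * e) * 2 ^ (1 + e) := Nat.mul_le_mul ih h1
      _ = 2 ^ (q + 1 + (q + 1 - 1) * e) := by
        rw [← pow_add]
        congr 1
        obtain ⟨p, rfl⟩ : ∃ p, q = p + 1 := ⟨q - 1, by omega⟩
        simp only [Nat.add_sub_cancel]
        ring

/-- The patterns from `r` vertices to a clique of size `m = j + 2 + e` are not more numerous than
the edges of the Turán graph between the two parts allow. -/
theorem pattern_pow_mul_le {j e : ℕ} (hj : 1 ≤ j) (he : 1 ≤ e) (r : ℕ) :
    2 ^ turanEdges (j + 2 + e) (j + 2) * (2 ^ j * (e + 2)) ^ r * 2 ^ turanEdges r (j + 2) ≤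
      2 ^ turanEdges (j + 2 + e + r) (j + 2) := by
  have hsup := turanEdges_superadd (q := j + 2) (by omega) (j + 2 + e) r
  have hE : (2 ^ j * (e + 2)) ^ (j + 2) ≤ 2 ^ ((j + 1) * (j + 2 + e)) := by
    calc (2 ^ j * (e + 2)) ^ (j + 2) = 2 ^ (j * (j + 2)) * (e + 2) ^ (j + 2) := by
          rw [mul_pow, ← pow_mul]
      _ ≤ 2 ^ (j * (j + 2)) * 2 ^ (j + 2 + (j + 2 - 1) * e) :=
          Nat.mul_le_mul_left _ (add_two_pow_le (by omega) he)
      _ = _ := by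
          rw [← pow_add]
          congr 1
          simp only [show j + 2 - 1 = j + 1 by omega]
          ring
  refine le_of_pow_le_pow_left₀ (n := j + 2) (by omega) (Nat.zero_le _) ?_
  calc (2 ^ turanEdges (j + 2 + e) (j + 2) * (2 ^ j * (e + 2)) ^ r *
        2 ^ turanEdges r (j + 2)) ^ (j + 2)
      = 2 ^ ((j + 2) * turanEdges (j + 2 + e) (j + 2) + (j + 2) * turanEdges r (j + 2)) *
        ((2 ^ j * (e + 2)) ^ (j + 2)) ^ r := by
        rw [mul_pow, mul_pow, ← pow_mul, ← pow_mul, ← pow_mul, ← pow_mul, pow_add]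
        rw [mul_comm r, mul_comm (j + 2) (turanEdges _ _), mul_comm (j + 2) (turanEdges _ _)]
        ring
    _ ≤ 2 ^ ((j + 2) * turanEdges (j + 2 + e) (j + 2) + (j + 2) * turanEdges r (j + 2)) *
        (2 ^ ((j + 1) * (j + 2 + e))) ^ r :=
        Nat.mul_le_mul_left _ (Nat.pow_le_pow_left hE r)
    _ = 2 ^ ((j + 2) * turanEdges (j + 2 + e) (j + 2) + (j + 2) * turanEdges r (j + 2) +
        (j + 1) * ((j + 2 + e) * r)) := by
        rw [← pow_mul, ← pow_add, mul_assoc]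
    _ ≤ 2 ^ ((j + 2) * turanEdges (j + 2 + e + r) (j + 2)) :=
        Nat.pow_le_pow_right (by norm_num) hsup
    _ = _ := by rw [← pow_mul, mul_comm]

/-- Passing from m = j + 2 + e to m + 1 vertices raises the Turán number t_(j+2) by j plus the
exponent on the right when q = j + 2. -/
theorem add_three_le_two_pow {e q : ℕ} (he : 1 ≤ e) (hq : 3 ≤ q) :
    e + 3 ≤ 2 ^ (1 + e - e / q) := by
  have h1 : e / q ≤ e / 3 := Nat.div_le_div_left hq (by norm_num)
  refine le_trans ?_ (Nat.pow_le_pow_right (by norm_num) (Nat.sub_le_sub_left h1 (1 + e)))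
  induction e using Nat.strong_induction_on with
  | _ e ih =>
  rcases le_or_gt e 3 with h | h
  · interval_cases e <;> norm_num
  · obtain ⟨f, rfl⟩ := Nat.exists_eq_add_of_le' h.le
    have := ih f (by omega) (by omega) (Nat.div_le_div_left hq (by norm_num))
    rw [show 1 + (f + 3) - (f + 3) / 3 = (1 + f - f / 3) + 2 by omega, pow_add]
    omega

theorem turanEdges_three_add_four (r : ℕ) :
    turanEdges (r + 4) 3 + r / 3 = turanEdges r 3 + 3 * r + 5 := by
  have h1 := turanEdges_succ (r := 3) (by norm_num) r
  have h2 := turanEdges_add (r + 1) 3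
  simp only [Nat.choose] at h2
  rw [show r + 1 + 3 = r + 4 by ring] at h2
  omega

/-- For `K_4` with r outside vertices, each having at most 6 patterns. At r = 3 it fails, since 8640
> 8192. From r to r + 3 the left side gains 216 and the right side at least 256. -/
theorem forty_mul_six_pow_lt {r : ℕ} (hr : 1 ≤ r) (h3 : r ≠ 3) :
    40 * 6 ^ r < 2 ^ (3 * r + 5 - r / 3) := by
  induction r using Nat.strong_induction_on with
  | _ r ih =>
  rcases le_or_gt r 6 with h | h
  · interval_cases r <;> first | exact absurd rfl h3 | norm_num
  · obtain ⟨f, rfl⟩ := Nat.exists_eq_add_of_le' (show 3 ≤ r by omega)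
    have := ih f (by omega) (by omega) (by omega)
    rw [show 3 * (f + 3) + 5 - (f + 3) / 3 = (3 * f + 5 - f / 3) + 8 by omega, pow_add, pow_add]
    omega

/-- The bound with four vertices outside the clique, where `40` replaces `2 ^ 5`. -/
theorem forty_mul_pattern_pow_le {e : ℕ} (he : 2 ≤ e) :
    2 ^ turanEdges (3 + e) 3 * (2 * (e + 2)) ^ 4 * 40 ≤ 2 ^ turanEdges (3 + e + 4) 3 := by
  have h := turanEdges_three_add_four (3 + e)
  have key : (2 * (e + 2)) ^ 4 * 40 ≤ 2 ^ (3 * (3 + e) + 5 - (3 + e) / 3) := by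
    clear h
    induction e using Nat.strong_induction_on with
    | _ e ih =>
    rcases le_or_gt e 4 with h | h
    · interval_cases e <;> norm_num
    · obtain ⟨f, rfl⟩ := Nat.exists_eq_add_of_le' (show 3 ≤ e by omega)
      have := ih f (by omega) (by omega)
      rw [show 3 * (3 + (f + 3)) + 5 - (3 + (f + 3)) / 3 =
        (3 * (3 + f) + 5 - (3 + f) / 3) + 8 by omega, pow_add]
      have h2 : (2 * (f + 3 + 2)) ^ 4 ≤ (2 * (2 * (f + 2))) ^ 4 :=
        Nat.pow_le_pow_left (by omega) 4
      have h3 : (2 * (2 * (f + 2))) ^ 4 = 16 * (2 * (f + 2)) ^ 4 := by rw [mul_pow]; norm_num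
      omega
  rw [mul_assoc, show turanEdges (3 + e + 4) 3 =
    turanEdges (3 + e) 3 + (3 * (3 + e) + 5 - (3 + e) / 3) by omega, pow_add]
  exact Nat.mul_le_mul_left _ key

end Estimates

/-! ### The clique inequality and complete graphs. -/

section Cliques

theorem numFreeOrientations_eq_of_forall_adj {U : Type*} [Fintype U] {k m : ℕ}
    {H : SimpleGraph U} (hH : ∀ a b, a ≠ b → H.Adj a b) (hU : Fintype.card U = m) :
    numFreeOrientations k H = numFreeOrientations k (⊤ : SimpleGraph (Fin m)) := by
  obtain rfl : H = ⊤ := by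
    ext a b
    exact ⟨fun h => h.ne, fun h => hH a b h⟩
  exact numFreeOrientations_congr (SimpleGraph.Iso.completeGraph (Fintype.equivFinOfCardEq hU))

theorem numFreeOrientations_le_two_pow_choose {U : Type*} [Fintype U] (k : ℕ)
    (H : SimpleGraph U) : numFreeOrientations k H ≤ 2 ^ (Fintype.card U).choose 2 := by
  classical
  exact (numFreeOrientations_le_two_pow k H).trans
    (Nat.pow_le_pow_right (by norm_num) SimpleGraph.card_edgeFinset_le_card_choose_two)

theorem numFreeOrientations_comap_of_isClique {V : Type*} {G : SimpleGraph V}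
    {W : Finset V} (hW : G.IsClique W) (k : ℕ) :
    numFreeOrientations k (G.comap (Subtype.val : {x // x ∈ W} → V)) =
      numFreeOrientations k (⊤ : SimpleGraph (Fin W.card)) :=
  numFreeOrientations_eq_of_forall_adj
    (fun a b hab => hW a.2 b.2 (fun h => hab (Subtype.ext h))) (by simp)

variable {V : Type*} [Fintype V] [DecidableEq V] {G : SimpleGraph V} {W : Finset V}

open Classical in
theorem numFreeOrientations_le_mul_pow {j e : ℕ} (hW : G.IsClique W)
    (hN : ∀ v ∉ W, (W.filter (G.Adj v)).card ≤ j + 1 + e) :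
    numFreeOrientations (j + 3) G ≤
      numFreeOrientations (j + 3) (⊤ : SimpleGraph (Fin W.card)) *
        (2 ^ j * (e + 2)) ^ (Fintype.card V - W.card) *
        numFreeOrientations (j + 3) (G.comap (Subtype.val : {x // x ∉ W} → V)) := by
  refine (numFreeOrientations_le_sum_prod (j + 3) G W).trans (Nat.mul_le_mul_right _ ?_)
  rw [← numFreeOrientations_comap_of_isClique hW, ← card_freeFinset, ← smul_eq_mul]
  refine Finset.sum_le_card_nsmul _ _ _ fun σ _ => ?_
  have hcard : Fintype.card V - W.card = (Finset.univ : Finset {x // x ∉ W}).card := by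
    rw [Finset.card_univ, Fintype.card_subtype_compl]
    simp
  rw [hcard]
  exact Finset.prod_le_pow_card _ _ _ fun v _ => card_patterns_le hW σ v.2 (by convert! hN v v.2)

theorem card_univ_erase_last (m : ℕ) :
    ((Finset.univ : Finset (Fin (m + 1))).erase (Fin.last m)).card = m := by simp

theorem numFreeOrientations_compl_erase_last (k m : ℕ) (H : SimpleGraph (Fin (m + 1))) :
    numFreeOrientations k (H.comap
      (Subtype.val : {x // x ∉ (Finset.univ : Finset (Fin (m + 1))).erase (Fin.last m)} → _)) ≤
      1 := by
  refine (numFreeOrientations_le_two_pow_choose _ _).trans ?_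
  rw [Fintype.card_subtype_compl]
  simp

theorem isClique_top {U : Type*} (s : Set U) : (⊤ : SimpleGraph U).IsClique s :=
  fun _ _ _ _ h => h

theorem numFreeOrientations_top_succ_le (j e : ℕ) :
    numFreeOrientations (j + 3) (⊤ : SimpleGraph (Fin (j + 2 + e + 1))) ≤
      numFreeOrientations (j + 3) (⊤ : SimpleGraph (Fin (j + 2 + e))) * (2 ^ j * (e + 3)) := by
  classical
  -- The removed vertex is adjacent to the whole remaining clique, so the pattern bound is used with
  -- e + 1.
  have h := numFreeOrientations_le_mul_pow (j := j) (e := e + 1)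
    (G := (⊤ : SimpleGraph (Fin (j + 2 + e + 1))))
    (W := Finset.univ.erase (Fin.last (j + 2 + e))) (isClique_top _) (fun v _ =>
      (@Finset.card_filter_le _ _ _ (_)).trans (by rw [card_univ_erase_last]; omega))
  rw [card_univ_erase_last, Fintype.card_fin, show j + 2 + e + 1 - (j + 2 + e) = 1 by omega,
    pow_one] at h
  refine h.trans ?_
  calc _ ≤ numFreeOrientations (j + 3) (⊤ : SimpleGraph (Fin (j + 2 + e))) *
        (2 ^ j * (e + 1 + 2)) * 1 :=
        Nat.mul_le_mul_left _ (numFreeOrientations_compl_erase_last _ _ _)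
    _ = _ := by ring

open Classical in
/-- Recursion for the number of tournaments which are not strong. -/
theorem numFreeOrientations_top_diag_succ_le (j : ℕ) :
    numFreeOrientations (j + 3) (⊤ : SimpleGraph (Fin (j + 3))) + 2 *
        numFreeOrientations (j + 2) (⊤ : SimpleGraph (Fin (j + 2))) ≤
      2 * 2 ^ (j + 2).choose 2 +
        3 * 2 ^ j * numFreeOrientations (j + 2) (⊤ : SimpleGraph (Fin (j + 2))) := by
  set W : Finset (Fin (j + 3)) := Finset.univ.erase (Fin.last (j + 2)) with hW
  have hWc : W.card = j + 2 := card_univ_erase_last (j + 2)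
  set H := (⊤ : SimpleGraph (Fin (j + 3))).comap (Subtype.val : {x // x ∈ W} → Fin (j + 3)) with hH
  have hcl : (⊤ : SimpleGraph (Fin (j + 3))).IsClique (W : Set (Fin (j + 3))) := isClique_top _
  have hF := numFreeOrientations_comap_of_isClique hcl (j + 2)
  rw [hWc] at hF
  rw [← hF]
  have hT : (freeFinset (j + 3) H).card ≤ 2 ^ (j + 2).choose 2 := by
    rw [card_freeFinset]
    refine (numFreeOrientations_le_two_pow_choose _ _).trans ?_
    rw [Fintype.card_coe, hWc]
  have h1 := numFreeOrientations_le_sum_prod (j + 3) (⊤ : SimpleGraph (Fin (j + 3))) W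
  have h2 := Nat.mul_le_mul_left (∑ σ ∈ freeFinset (j + 3) H,
        ∏ v : {x // x ∉ W}, (patterns (j + 3) ⊤ W σ v).card)
        (numFreeOrientations_compl_erase_last (j + 3) (j + 2) (⊤ : SimpleGraph (Fin (j + 3))))
  have h3 := h1.trans h2
  rw [mul_one] at h3
  have hone : (Finset.univ : Finset {x // x ∉ W}).card = 1 := by
    rw [Finset.card_univ, Fintype.card_subtype_compl]
    simp [hW]
  -- Over a strong σ the last vertex is a source or a sink; over the others the general bound 3 ·
  -- 2^j is enough.
  have hprod : ∀ σ, ∏ v : {x // x ∉ W}, (patterns (j + 3) ⊤ W σ v).card ≤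
      if CutStrong σ Finset.univ then 2 else 3 * 2 ^ j := by
    intro σ
    refine (Finset.prod_le_pow_card _ _ (if CutStrong σ Finset.univ then 2 else 3 * 2 ^ j)
      fun v _ => ?_).trans (by rw [hone, pow_one])
    split_ifs with hσ
    · exact card_patterns_le_two hcl hσ v.2 (fun w hw h => v.2 (h ▸ hw)) (by omega)
    · refine (card_patterns_le (j := j) (e := 1) hcl σ v.2 ?_).trans (by omega)
      exact (@Finset.card_filter_le _ _ _ (_)).trans (by omega)
  have h4 := h3.trans (Finset.sum_le_sum fun σ _ => hprod σ)
  rw [Finset.sum_ite, Finset.sum_const, Finset.sum_const, smul_eq_mul, smul_eq_mul] at h4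
  have hns : ((freeFinset (j + 3) H).filter (¬ CutStrong · Finset.univ)).card ≤
      numFreeOrientations (j + 2) H := by
    rw [← card_freeFinset]
    refine Finset.card_le_card fun σ hσ => ?_
    rw [Finset.mem_filter, mem_freeFinset, mem_freeOrientations_iff] at hσ
    rw [mem_freeFinset, mem_freeOrientations_iff]
    refine ⟨hσ.1.1, fun s hs => ?_⟩
    have : s = Finset.univ := by
      rw [← Finset.card_eq_iff_eq_univ, hs.card_eq, Fintype.card_coe, hWc]
    rw [this]
    exact hσ.2
  have hsplit := Finset.card_filter_add_card_filter_not (s := freeFinset (j + 3) H)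
    (CutStrong · Finset.univ)
  generalize ((freeFinset (j + 3) H).filter (¬ CutStrong · Finset.univ)).card = A at *
  generalize ((freeFinset (j + 3) H).filter (CutStrong · Finset.univ)).card = B at *
  generalize numFreeOrientations (j + 2) H = F at *
  obtain ⟨d, rfl⟩ := Nat.exists_eq_add_of_le hns
  have hp : 1 ≤ 2 ^ j := Nat.one_le_two_pow
  have hd : d * 1 ≤ d * 2 ^ j := Nat.mul_le_mul_left d hp
  nlinarith

/-- `K_k` has one edge more than the Turán graph on k vertices, so the non-strong tournaments must
be fewer than half of all. This is false on four vertices, where they number 40 of 64. -/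
theorem two_mul_numFreeOrientations_top_lt {j : ℕ} (hj : 2 ≤ j) :
    2 * numFreeOrientations (j + 3) (⊤ : SimpleGraph (Fin (j + 3))) < 2 ^ (j + 3).choose 2 := by
  induction j, hj using Nat.le_induction with
  | base =>
    have h := numFreeOrientations_five_top_five
    have : (2 + 3).choose 2 = 10 := rfl
    rw [this]
    norm_num
    omega
  | succ j hj ih =>
    have h := numFreeOrientations_top_diag_succ_le (j + 1)
    simp only [show j + 1 + 3 = j + 4 by ring, show j + 1 + 2 = j + 3 by ring] at h ⊢
    have hc : (j + 4).choose 2 = (j + 3) + (j + 3).choose 2 := by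
      rw [Nat.choose_succ_succ' (j + 3) 1]; simp
    rw [hc, pow_add]
    have hp : 2 ^ (j + 3) = 4 * 2 ^ (j + 1) := by rw [pow_add, pow_add]; ring
    have hq : 2 ≤ 2 ^ (j + 1) := by
      calc 2 = 2 ^ 1 := rfl
        _ ≤ 2 ^ (j + 1) := Nat.pow_le_pow_right (by norm_num) (by omega)
    rw [hp]
    generalize numFreeOrientations (j + 4) (⊤ : SimpleGraph (Fin (j + 4))) = F' at *
    generalize numFreeOrientations (j + 3) (⊤ : SimpleGraph (Fin (j + 3))) = F at *
    generalize 2 ^ (j + 3).choose 2 = T at *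
    generalize 2 ^ (j + 1) = P at *
    obtain ⟨Q, rfl⟩ := Nat.exists_eq_add_of_le hq
    nlinarith [Nat.zero_le (Q * F), Nat.zero_le (Q * T), Nat.mul_le_mul_left Q ih.le]

/-- Complete graphs have fewer free orientations than the Turán graph of the same order. -/
theorem numFreeOrientations_top_lt {j e : ℕ} (hj : 1 ≤ j) (he : 1 ≤ e) (hje : 2 ≤ j ∨ 2 ≤ e) :
    numFreeOrientations (j + 3) (⊤ : SimpleGraph (Fin (j + 2 + e))) <
      2 ^ turanEdges (j + 2 + e) (j + 2) := by
  -- One more vertex multiplies the count by at most 2^j (e + 3), and 2^t by at least as much.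
  have step : ∀ e, 1 ≤ e → numFreeOrientations (j + 3) (⊤ : SimpleGraph (Fin (j + 2 + e))) <
      2 ^ turanEdges (j + 2 + e) (j + 2) →
      numFreeOrientations (j + 3) (⊤ : SimpleGraph (Fin (j + 2 + (e + 1)))) <
      2 ^ turanEdges (j + 2 + (e + 1)) (j + 2) := by
    intro e he h
    have h1 := numFreeOrientations_top_succ_le j e
    have h2 := turanEdges_succ (r := j + 2) (by omega) (j + 2 + e)
    have h3 := add_three_le_two_pow he (show 3 ≤ j + 2 by omega)
    rw [show j + 2 + e = e + (j + 2) by ring, Nat.add_div_right _ (by omega),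
      show e + (j + 2) = j + 2 + e by ring] at h2
    have hd : e / (j + 2) ≤ e := Nat.div_le_self _ _
    have h4 : turanEdges (j + 2 + (e + 1)) (j + 2) =
        turanEdges (j + 2 + e) (j + 2) + (j + (1 + e - e / (j + 2))) := by
      rw [← add_assoc (j + 2)]; omega
    rw [h4, pow_add, pow_add]
    calc _ ≤ _ := h1
      _ < 2 ^ turanEdges (j + 2 + e) (j + 2) * (2 ^ j * (e + 3)) :=
        Nat.mul_lt_mul_of_pos_right h (by positivity)
      _ ≤ _ := Nat.mul_le_mul_left _ (Nat.mul_le_mul_left _ h3)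
  by_cases h2 : 2 ≤ j
  · clear hje
    induction e, he using Nat.le_induction with
    | base =>
      have h := two_mul_numFreeOrientations_top_lt h2
      have h4 := turanEdges_succ (r := j + 2) (by omega) (j + 2)
      rw [Nat.div_self (by omega), turanEdges_of_le le_rfl] at h4
      have hc : (j + 3).choose 2 = (j + 2) + (j + 2).choose 2 := by
        rw [Nat.choose_succ_succ' (j + 2) 1]; simp
      rw [show (j + 3).choose 2 = turanEdges (j + 2 + 1) (j + 2) + 1 by omega, pow_succ] at h
      have h5 : numFreeOrientations (j + 3) (⊤ : SimpleGraph (Fin (j + 3))) <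
        2 ^ turanEdges (j + 2 + 1) (j + 2) := by omega
      exact h5
    | succ e he ih => exact step e he ih
  · obtain rfl : j = 1 := by omega
    have he2 : 2 ≤ e := by omega
    clear hje
    induction e, he2 using Nat.le_induction with
    | base =>
      have h := numFreeOrientations_four_top_five
      have h4 := turanEdges_three_add_four 1
      rw [turanEdges_of_le (show 1 ≤ 3 by norm_num)] at h4
      have h5 : turanEdges (1 + 2 + 2) (1 + 2) = 8 := by
        change turanEdges (1 + 4) 3 = 8
        simp only [Nat.choose] at h4
        omega
      rw [h5]
      exact lt_of_le_of_lt h (by norm_num)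
    | succ e he' ih => exact step e (by omega) (ih (by omega))

end Cliques

/-! ### The exceptional case k = 4, n = 7. -/

section SevenVertices

variable {V : Type*} [Fintype V] [DecidableEq V] {G : SimpleGraph V} {W : Finset V}

open Classical in
/-- The orientations of `G[W]` together with the patterns of one more vertex `v` are determined by
orientations of any induced subgraph containing `W` and `v`. -/
theorem sum_card_patterns_le {U : Type*} [Finite U] (k : ℕ) (f : U ↪ V) {v : V}
    (hW : ∀ w ∈ W, w ∈ Set.range f) (hv : v ∈ Set.range f) :
    ∑ σ ∈ freeFinset k (G.comap (Subtype.val : {x // x ∈ W} → V)), (patterns k G W σ v).card ≤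
      numFreeOrientations k (G.comap f) := by
  rw [← Finset.card_sigma, ← card_freeFinset]
  have hex : ∀ c : (_ : Digraph {x // x ∈ W}) × Finset V, c.2 ∈ patterns k G W c.1 v →
      ∃ D ∈ freeOrientations k G, D.pullback (Subtype.val : {x // x ∈ W} → V) = c.1 ∧
        ∀ w ∈ W, (w ∈ c.2 ↔ D.Adj v w) := fun c hc => (Finset.mem_filter.1 hc).2
  choose! ext h1 h2 h3 using hex
  refine Finset.card_le_card_of_injOn (fun c => (ext c).pullback f) ?_ ?_
  · intro c hc
    have hc := (Finset.mem_sigma.1 hc).2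
    exact mem_freeFinset.2 (pullback_mem_freeOrientations f (h1 c hc))
  · intro c hc c' hc' h
    have hc := (Finset.mem_sigma.1 hc).2
    have hc' := (Finset.mem_sigma.1 hc').2
    have key : ∀ a ∈ Set.range f, ∀ b ∈ Set.range f, ((ext c).Adj a b ↔ (ext c').Adj a b) := by
      rintro _ ⟨a, rfl⟩ _ ⟨b, rfl⟩
      exact Eq.to_iff (congrArg (fun K : Digraph U => K.Adj a b) h)
    have e1 : c.1 = c'.1 := by
      rw [← h2 c hc, ← h2 c' hc']
      ext a b
      exact key a (hW a a.2) b (hW b b.2)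
    have e2 : c.2 = c'.2 := by
      ext w
      by_cases hw : w ∈ W
      · rw [h3 c hc w hw, h3 c' hc' w hw]
        exact key v hv w (hW w hw)
      · exact ⟨fun h => absurd (Finset.mem_powerset.1 (Finset.mem_filter.1 hc).1 h) hw,
          fun h => absurd (Finset.mem_powerset.1 (Finset.mem_filter.1 hc').1 h) hw⟩
    exact Sigma.ext e1 (heq_of_eq e2)

open Classical in
-- With three neighbours, v and `W` span `K_5` minus an edge, whose count 224 improves on the
-- product 40 · 6; with fewer neighbours 40 · 4 suffices.
theorem sum_card_patterns_le_of_card_eq_four (hW : G.IsClique W) (hc : W.card = 4) {v : V}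
    (hv : v ∉ W) (hN : (W.filter (G.Adj v)).card ≤ 3) :
    ∑ σ ∈ freeFinset 4 (G.comap (Subtype.val : {x // x ∈ W} → V)), (patterns 4 G W σ v).card ≤
      224 := by
  rcases Nat.lt_or_ge (W.filter (G.Adj v)).card 3 with h | h
  · calc _ ≤ ∑ σ ∈ freeFinset 4 (G.comap (Subtype.val : {x // x ∈ W} → V)), 4 :=
          Finset.sum_le_sum fun σ _ => by
            refine (card_patterns_le (j := 1) (e := 0) hW σ hv ?_).trans (by norm_num)
            convert! Nat.le_of_lt_succ h
      _ = 160 := by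
          rw [Finset.sum_const, card_freeFinset, numFreeOrientations_comap_of_isClique hW, hc,
            numFreeOrientations_four_top_four]
          rfl
      _ ≤ 224 := by norm_num
  · obtain ⟨a, b, c, hab, hac, hbc, habc⟩ := Finset.card_eq_three.1 (le_antisymm hN h)
    have hd : (W \ W.filter (G.Adj v)).card = 1 := by
      rw [Finset.card_sdiff_of_subset (Finset.filter_subset _ _)]; omega
    obtain ⟨d, hd⟩ := Finset.card_eq_one.1 hd
    have ha : a ∈ W.filter (G.Adj v) := by simp [habc]
    have hb : b ∈ W.filter (G.Adj v) := by simp [habc]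
    have hc' : c ∈ W.filter (G.Adj v) := by simp [habc]
    have hdm : d ∈ W \ W.filter (G.Adj v) := by simp [hd]
    rw [Finset.mem_filter] at ha hb hc'
    rw [Finset.mem_sdiff, Finset.mem_filter] at hdm
    have had : a ≠ d := by rintro rfl; tauto
    have hbd : b ≠ d := by rintro rfl; tauto
    have hcd : c ≠ d := by rintro rfl; tauto
    have hav := ha.2.ne'
    have hbv := hb.2.ne'
    have hcv := hc'.2.ne'
    have hdv : d ≠ v := fun e => hv (e ▸ hdm.1)
    have hinj : Function.Injective ![a, b, c, d, v] := by
      intro i i' h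
      fin_cases i <;> fin_cases i' <;> simp_all
    have gab := hW ha.1 hb.1 hab
    have gac := hW ha.1 hc'.1 hac
    have gad := hW ha.1 hdm.1 had
    have gbc := hW hb.1 hc'.1 hbc
    have gbd := hW hb.1 hdm.1 hbd
    have gcd := hW hc'.1 hdm.1 hcd
    have gvd : ¬ G.Adj v d := fun h => hdm.2 ⟨hdm.1, h⟩
    have gdv : ¬ G.Adj d v := fun h => gvd h.symm
    have hG : G.comap (⟨![a, b, c, d, v], hinj⟩ : Fin 5 ↪ V) = fiveMinusEdge := by
      ext i i'
      fin_cases i <;> fin_cases i' <;>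
        simp [fiveMinusEdge, gab, gac, gad, gbc, gbd, gcd, gvd, ha.2, hb.2, hc'.2, gab.symm,
          gac.symm, gad.symm, gbc.symm, gbd.symm, gcd.symm, ha.2.symm, hb.2.symm, hc'.2.symm,
          gdv]
    refine (sum_card_patterns_le 4 (⟨![a, b, c, d, v], hinj⟩ : Fin 5 ↪ V) ?_ ⟨4, rfl⟩).trans ?_
    · intro w hw
      by_cases hwv : G.Adj v w
      · have : w ∈ W.filter (G.Adj v) := Finset.mem_filter.2 ⟨hw, hwv⟩
        rw [habc] at this
        simp only [Finset.mem_insert, Finset.mem_singleton] at this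
        rcases this with rfl | rfl | rfl
        exacts [⟨0, rfl⟩, ⟨1, rfl⟩, ⟨2, rfl⟩]
      · have : w ∈ W \ W.filter (G.Adj v) :=
          Finset.mem_sdiff.2 ⟨hw, fun h => hwv (Finset.mem_filter.1 h).2⟩
        rw [hd, Finset.mem_singleton] at this
        exact ⟨3, this.symm⟩
    · rw [hG]
      exact numFreeOrientations_four_fiveMinusEdge

open Classical in
-- The plain product 40 · 6^3 · 2^3 = 69120 exceeds 2^16 = 65536. Counting one outside vertex
-- jointly with `W` gives 224 · 6^2 · 2^3 = 64512.
theorem numFreeOrientations_four_lt_of_card_eq_seven (hV : Fintype.card V = 7)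
    (hW : G.IsClique W) (hc : W.card = 4) (hN : ∀ v ∉ W, (W.filter (G.Adj v)).card ≤ 3) :
    numFreeOrientations 4 G < 2 ^ 16 := by
  have hcompl : Fintype.card {x // x ∉ W} = 3 := by
    rw [Fintype.card_subtype_compl, hV, Fintype.card_coe, hc]
  obtain ⟨v⟩ : Nonempty {x // x ∉ W} := Fintype.card_pos_iff.1 (by omega)
  have h8 := numFreeOrientations_le_two_pow_choose 4 (G.comap (Subtype.val : {x // x ∉ W} → V))
  rw [hcompl] at h8
  have hsum : ∑ σ ∈ freeFinset 4 (G.comap (Subtype.val : {x // x ∈ W} → V)),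
      ∏ v : {x // x ∉ W}, (patterns 4 G W σ v).card ≤ 224 * 36 := by
    refine le_trans ?_ (Nat.mul_le_mul_right 36
      (sum_card_patterns_le_of_card_eq_four hW hc v.2 (hN v v.2)))
    rw [Finset.sum_mul]
    refine Finset.sum_le_sum fun σ _ => ?_
    rw [← Finset.mul_prod_erase _ _ (Finset.mem_univ v)]
    refine Nat.mul_le_mul_left _ ?_
    refine (Finset.prod_le_pow_card _ _ 6 fun u _ => ?_).trans ?_
    · exact card_patterns_le (j := 1) (e := 1) hW σ u.2 (by convert! hN u u.2)
    · rw [Finset.card_erase_of_mem (Finset.mem_univ v), Finset.card_univ, hcompl]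
      norm_num
  calc numFreeOrientations 4 G ≤ _ := numFreeOrientations_le_sum_prod 4 G W
    _ ≤ 224 * 36 * 2 ^ (Nat.choose 3 2) := Nat.mul_le_mul hsum h8
    _ < 2 ^ 16 := by simp [Nat.choose]

end SevenVertices

/-! ### The induction and the extremal graphs. -/

section Main

open Classical in
theorem card_edgeFinset_le_turanEdges {V : Type*} [Fintype V] {G : SimpleGraph V} {r : ℕ}
    (h : G.CliqueFree (r + 1)) : G.edgeFinset.card ≤ turanEdges (Fintype.card V) r := by
  have := SimpleGraph.CliqueFree.card_edgeFinset_le h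
  rw [turanEdges, SimpleGraph.card_edgeFinset_turanGraph]
  exact this

theorem numFreeOrientations_le_of_cliqueFree {V : Type*} [Fintype V] {G : SimpleGraph V} {r : ℕ}
    (h : G.CliqueFree (r + 1)) :
    numFreeOrientations (r + 1) G ≤ 2 ^ turanEdges (Fintype.card V) r := by
  classical
  rw [numFreeOrientations_of_cliqueFree h]
  exact Nat.pow_le_pow_right (by norm_num) (card_edgeFinset_le_turanEdges h)

theorem numFreeOrientations_lt_of_ne_top {V : Type*} [Fintype V] {G : SimpleGraph V}
    (hV : Fintype.card V = 4) (hG : G ≠ ⊤) (k : ℕ) : numFreeOrientations k G < 40 := by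
  classical
  have h1 : G.edgeFinset.card < (⊤ : SimpleGraph V).edgeFinset.card :=
    Finset.card_lt_card (SimpleGraph.edgeFinset_ssubset_edgeFinset.2 (lt_top_iff_ne_top.2 hG))
  rw [SimpleGraph.card_edgeFinset_top_eq_card_choose_two, hV] at h1
  simp only [Nat.choose] at h1
  calc numFreeOrientations k G ≤ 2 ^ G.edgeFinset.card := numFreeOrientations_le_two_pow k G
    _ ≤ 2 ^ 5 := Nat.pow_le_pow_right (by norm_num) (by omega)
    _ < 40 := by norm_num

theorem numFreeOrientations_four_top {V : Type*} [Fintype V] (hV : Fintype.card V = 4) :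
    numFreeOrientations 4 (⊤ : SimpleGraph V) = 40 := by
  rw [numFreeOrientations_eq_of_forall_adj (fun a b h => h) hV, numFreeOrientations_four_top_four]

theorem numFreeOrientations_four_le {V : Type*} [Fintype V] (G : SimpleGraph V)
    (hV : Fintype.card V = 4) : numFreeOrientations 4 G ≤ 40 := by
  rcases eq_or_ne G ⊤ with rfl | h
  · exact (numFreeOrientations_four_top hV).le
  · exact (numFreeOrientations_lt_of_ne_top hV h 4).le

/-- A graph containing `K_k` has fewer free orientations than the Turán graph of the same
order. -/
theorem numFreeOrientations_lt_of_not_cliqueFree {j : ℕ} (hj : 1 ≤ j) (n : ℕ) :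
    ∀ (V : Type*) [Fintype V] (G : SimpleGraph V), Fintype.card V = n → ¬ (j = 1 ∧ n = 4) →
      ¬ G.CliqueFree (j + 3) → numFreeOrientations (j + 3) G < 2 ^ turanEdges n (j + 2) := by
  induction n using Nat.strong_induction_on with
  | _ n ih =>
  intro V _ G hV hn hG
  classical
  obtain ⟨W, hWm⟩ := G.exists_isNClique_cliqueNum
  have hW := hWm.isClique
  have hm : j + 3 ≤ W.card := by
    simp only [SimpleGraph.CliqueFree, not_forall, not_not] at hG
    obtain ⟨s, hs⟩ := hG
    rw [hWm.card_eq, ← hs.card_eq]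
    exact hs.isClique.card_le_cliqueNum
  obtain ⟨e, he, hWe⟩ : ∃ e, 1 ≤ e ∧ W.card = j + 2 + e := ⟨W.card - (j + 2), by omega, by omega⟩
  obtain ⟨r, hr⟩ : ∃ r, n = j + 2 + e + r :=
    Nat.exists_eq_add_of_le (by rw [← hWe, ← hV]; exact Finset.card_le_univ W)
  -- An outside vertex adjacent to all of `W` would enlarge the maximum clique.
  have hN : ∀ v ∉ W, (W.filter (G.Adj v)).card ≤ j + 1 + e := by
    intro v hv
    by_contra hlt
    have hfil : W.filter (G.Adj v) = W :=
      Finset.eq_of_subset_of_card_le (Finset.filter_subset _ _) (by omega)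
    have hcl : G.IsClique (insert v W : Finset V) := by
      rw [Finset.coe_insert]
      refine hW.insert fun b hb _ => ?_
      rw [Finset.mem_coe, ← hfil, Finset.mem_filter] at hb
      exact hb.2
    have := hcl.card_le_cliqueNum
    rw [Finset.card_insert_of_notMem hv, ← hWm.card_eq] at this
    omega
  have hmul := numFreeOrientations_le_mul_pow (j := j) hW hN
  have hcompl : Fintype.card {x // x ∉ W} = r := by
    rw [Fintype.card_subtype_compl, Fintype.card_coe]; omega
  rw [hWe, show Fintype.card V - (j + 2 + e) = r by omega] at hmul
  have hrest : ¬ (j = 1 ∧ r = 4) →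
      numFreeOrientations (j + 3) (G.comap (Subtype.val : {x // x ∉ W} → V)) ≤
        2 ^ turanEdges r (j + 2) := by
    intro hjr
    by_cases hf : (G.comap (Subtype.val : {x // x ∉ W} → V)).CliqueFree (j + 3)
    · have := numFreeOrientations_le_of_cliqueFree (r := j + 2) hf
      rwa [hcompl] at this
    · exact (ih r (by omega) _ _ hcompl hjr hf).le
  have hrest4 : j = 1 → r = 4 →
      numFreeOrientations (j + 3) (G.comap (Subtype.val : {x // x ∉ W} → V)) ≤ 40 := by
    rintro rfl rfl
    exact numFreeOrientations_four_le _ hcompl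
  rw [hr]
  by_cases hbig : 2 ≤ j ∨ 2 ≤ e
  · have hK := numFreeOrientations_top_lt hj he hbig
    by_cases hjr : j = 1 ∧ r = 4
    · obtain ⟨rfl, rfl⟩ := hjr
      calc _ ≤ _ := hmul
        _ ≤ numFreeOrientations 4 (⊤ : SimpleGraph (Fin (3 + e))) * (2 ^ 1 * (e + 2)) ^ 4 * 40 :=
          Nat.mul_le_mul_left _ (hrest4 rfl rfl)
        _ < 2 ^ turanEdges (3 + e) 3 * (2 ^ 1 * (e + 2)) ^ 4 * 40 := by gcongr
        _ ≤ _ := forty_mul_pattern_pow_le (by omega)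
    · calc _ ≤ _ := hmul
        _ ≤ numFreeOrientations (j + 3) (⊤ : SimpleGraph (Fin (j + 2 + e))) *
            (2 ^ j * (e + 2)) ^ r * 2 ^ turanEdges r (j + 2) := Nat.mul_le_mul_left _ (hrest hjr)
        _ < 2 ^ turanEdges (j + 2 + e) (j + 2) * (2 ^ j * (e + 2)) ^ r *
            2 ^ turanEdges r (j + 2) := by gcongr
        _ ≤ _ := pattern_pow_mul_le hj he r
  · obtain rfl : j = 1 := by omega
    obtain rfl : e = 1 := by omega
    have h4 := turanEdges_three_add_four r
    have hK : numFreeOrientations (1 + 3) (⊤ : SimpleGraph (Fin (1 + 2 + 1))) = 40 :=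
      numFreeOrientations_four_top_four
    rw [hK] at hmul
    change _ < 2 ^ turanEdges (4 + r) 3
    rw [add_comm 4 r]
    rcases eq_or_ne r 3 with rfl | h3
    · rw [turanEdges_of_le (n := 3) le_rfl] at h4
      rw [show turanEdges (3 + 4) 3 = 16 by simp only [Nat.choose] at h4; omega]
      exact numFreeOrientations_four_lt_of_card_eq_seven (by omega) hW hWe hN
    -- r = 0 is the excluded case n = k = 4.
    have hr1 : 1 ≤ r := by omega
    have h40 := forty_mul_six_pow_lt hr1 h3
    -- The complement may be a `K_4` with 40 > 2^5 orientations; still 40 · 6^4 · 40 = 2073600 <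
    -- 2^21.
    rcases eq_or_ne r 4 with rfl | hr4
    · have h0 := turanEdges_three_add_four 0
      rw [turanEdges_of_le (n := 0) (by norm_num)] at h0
      simp only [Nat.choose] at h0
      norm_num at h0 h4
      rw [show turanEdges (4 + 4) 3 = 21 by norm_num; omega]
      calc _ ≤ _ := hmul
        _ ≤ 40 * (2 ^ 1 * (1 + 2)) ^ 4 * 40 := Nat.mul_le_mul_left _ (hrest4 rfl rfl)
        _ < 2 ^ 21 := by norm_num
    · have hle : r / 3 ≤ 3 * r + 5 := by omega
      rw [show turanEdges (r + 4) 3 = (3 * r + 5 - r / 3) + turanEdges r 3 by omega, pow_add]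
      calc _ ≤ _ := hmul
        _ ≤ 40 * (2 ^ 1 * (1 + 2)) ^ r * 2 ^ turanEdges r 3 :=
          Nat.mul_le_mul_left _ (hrest (by omega))
        _ < _ := Nat.mul_lt_mul_of_pos_right (by simpa using h40) (by positivity)

theorem numFreeOrientations_turanGraph {j : ℕ} (n : ℕ) :
    numFreeOrientations (j + 3) (SimpleGraph.turanGraph n (j + 2)) =
      2 ^ turanEdges n (j + 2) :=
  numFreeOrientations_of_cliqueFree (SimpleGraph.turanGraph_cliqueFree (by omega))

theorem numFreeOrientations_le_turan {j : ℕ} (hj : 1 ≤ j) {V : Type*} [Fintype V]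
    (G : SimpleGraph V) (hn : ¬ (j = 1 ∧ Fintype.card V = 4)) :
    numFreeOrientations (j + 3) G ≤ 2 ^ turanEdges (Fintype.card V) (j + 2) := by
  by_cases h : G.CliqueFree (j + 3)
  · exact numFreeOrientations_le_of_cliqueFree (r := j + 2) h
  · exact (numFreeOrientations_lt_of_not_cliqueFree hj _ V G rfl hn h).le

/-- Equality rules out a `K_k`, the count is then 2^e(G), and uniqueness in Turán's theorem applies.
-/
theorem numFreeOrientations_eq_turan_iff {j : ℕ} (hj : 1 ≤ j) {V : Type*} [Fintype V]
    (G : SimpleGraph V) (hn : ¬ (j = 1 ∧ Fintype.card V = 4)) :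
    numFreeOrientations (j + 3) G = 2 ^ turanEdges (Fintype.card V) (j + 2) ↔
      Nonempty (G ≃g SimpleGraph.turanGraph (Fintype.card V) (j + 2)) := by
  classical
  constructor
  · intro h
    have hfree : G.CliqueFree (j + 2 + 1) := by
      by_contra hf
      exact (numFreeOrientations_lt_of_not_cliqueFree hj _ V G rfl hn hf).ne h
    have he : numFreeOrientations (j + 3) G = 2 ^ G.edgeFinset.card :=
      numFreeOrientations_of_cliqueFree hfree
    rw [he] at h
    have he := Nat.pow_right_injective (le_refl 2) h
    rw [← SimpleGraph.isTuranMaximal_iff_nonempty_iso_turanGraph (by omega)]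
    refine ⟨hfree, fun H _ hH => ?_⟩
    rw [he]
    convert! card_edgeFinset_le_turanEdges hH
  · rintro ⟨f⟩
    rw [numFreeOrientations_congr f, numFreeOrientations_turanGraph]

theorem maxFreeOrientations_eq_of_forall_le {k n N : ℕ} {H : SimpleGraph (Fin n)}
    (hH : numFreeOrientations k H = N)
    (h : ∀ G : SimpleGraph (Fin n), numFreeOrientations k G ≤ N) :
    maxFreeOrientations k n = N := by
  refine le_antisymm (Finset.sup_le fun G _ => h G) ?_
  rw [← hH]
  exact Finset.le_sup (f := fun G => numFreeOrientations k G) (Finset.mem_univ H)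

theorem theorem3p7 (n k : ℕ) (hk : 4 ≤ k) (hn : k ≤ n) :
    (n = 4 ∧ k = 4 →
      maxFreeOrientations k n = 40 ∧
      ∀ (V : Type*) [Fintype V] (G : SimpleGraph V), Fintype.card V = n →
        (IsStrongExtremal k G ↔ Nonempty (G ≃g SimpleGraph.completeGraph (Fin 4)))) ∧
    (5 ≤ n ∨ 5 ≤ k →
      maxFreeOrientations k n = 2 ^ turanEdges n (k - 1) ∧
      ∀ (V : Type*) [Fintype V] (G : SimpleGraph V), Fintype.card V = n →
        (IsStrongExtremal k G ↔ Nonempty (G ≃g SimpleGraph.turanGraph n (k - 1)))) := by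
  constructor
  · rintro ⟨rfl, rfl⟩
    have hmax : maxFreeOrientations 4 4 = 40 :=
      maxFreeOrientations_eq_of_forall_le numFreeOrientations_four_top_four
        fun G => numFreeOrientations_four_le G (by simp)
    refine ⟨hmax, fun V _ G hV => ?_⟩
    rw [IsStrongExtremal, hV, hmax]
    constructor
    · intro h
      rcases eq_or_ne G ⊤ with rfl | hG
      · exact ⟨SimpleGraph.Iso.completeGraph (Fintype.equivFinOfCardEq hV)⟩
      · exact absurd h (numFreeOrientations_lt_of_ne_top hV hG 4).ne
    · rintro ⟨f⟩
      rw [numFreeOrientations_congr f]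
      exact numFreeOrientations_four_top_four
  · intro h5
    obtain ⟨j, rfl⟩ : ∃ j, k = j + 3 := ⟨k - 3, by omega⟩
    rw [show j + 3 - 1 = j + 2 by omega]
    have hj : 1 ≤ j := by omega
    have hmax : maxFreeOrientations (j + 3) n = 2 ^ turanEdges n (j + 2) := by
      refine maxFreeOrientations_eq_of_forall_le (numFreeOrientations_turanGraph n) fun G => ?_
      have := numFreeOrientations_le_turan hj G (by rw [Fintype.card_fin]; omega)
      rwa [Fintype.card_fin] at this
    refine ⟨hmax, fun V _ G hV => ?_⟩
    subst hV
    rw [IsStrongExtremal, hmax]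
    exact numFreeOrientations_eq_turan_iff hj G (by omega)

end Main
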